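/- Let $\Delta$ be the set of Borel probability distributions on $[0,\infty)$, a distribution being identified with its distribution function $F$, and let $V\sim F$ denote the buyer's value. A distribution $F\in\Delta$ has monotone hazard rate (MHR) if on $\{v: F(v)<1\}$ it has a density $f$ for which $f/(1-F)$ is non-decreasing; an atom at the right end of this set is allowed, so that point masses and truncated exponential distributions are MHR. Put $\mathrm{OPT}(F)=\sup_v v\cdot \Pr_{V\sim F}[V\ge v]$. A pricing rule is a function $h:\mathbb R\times\Delta\to\mathbb R$, measurable in its first argument, such that all expectations $\mathbb E_{s\sim F}[h(s,F')]$ with $F,F'\in\Delta$ exist in $(-\infty,+\infty]$. It is proper if $\mathbb E_{s\sim F}[h(s,F)]\le \mathbb E_{s\sim F}[h(s,F')]$ for all $F,F'\in\Delta$. Its pricing policy is $p_h(F)=\mathbb E_{s\sim F}[h(s,F)]$, and the corresponding hidden pricing mechanism has allocation $x(s,v,F)=\mathbf 1[v\ge p_h(F)]$ and payment $t(s,v,F)=x(s,v,F)\,h(s,F)$, where $s$ is the seller's hidden sample, $v$ the reported value and $F$ the reported distribution. The mechanism is monotone if $p_h(F_1)\ge p_h(F_2)$ whenever $F_1$ first-order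 stochastically dominates $F_2$, that is, $F_1(v)\le F_2(v)$ for all $v$. The approximation ratio of a mechanism over MHR distributions is $$\inf_{F\ \mathrm{MHR},\ \mathrm{OPT}(F)>0}\ \frac{\mathbb E_{s\sim F,\,v\sim F}[t(s,v,F)]}{\mathrm{OPT}(F)},$$ where $s$ and $v$ are independent. Then among all monotone hidden pricing mechanisms given by proper pricing rules there is one with the largest approximation ratio over MHR distributions, and this largest ratio $\Gamma^*$ satisfies $$0.79\le \Gamma^*\le 0.796 .$$ -/

import Mathlib

open MeasureTheory

noncomputable section

namespace HiddenPricing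

/-- Value distributions: Borel probability measures on the line carried by `[0, ∞)`. -/
def Dist : Type :=
  {F : Measure ℝ // IsProbabilityMeasure F ∧ F (Set.Iio 0) = 0}

/-- The underlying measure of a value distribution. -/
def Dist.law (F : Dist) : Measure ℝ := F.1

instance (F : Dist) : IsProbabilityMeasure F.law := F.2.1

/-- The distribution function `v ↦ P(V ≤ v)`. -/
def Dist.cdf (F : Dist) (v : ℝ) : ℝ := ProbabilityTheory.cdf F.law v

/-- Monotone hazard rate: on the set where the distribution function is below `1`, the distribution
has a density `f` whose hazard rate `f / (1 - F)` is non-decreasing (equivalently, the virtual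
value `-(1 - F) / f` is non-decreasing, read as `-∞` where `f = 0`).  If the set where the
distribution function is below `1` is bounded above, the remaining mass is an atom at its
supremum; in particular point masses and truncated exponential distributions belong to the
class. -/
def IsMHR (F : Dist) : Prop :=
  ∃ f : ℝ → ℝ, (∀ v, 0 ≤ f v) ∧
    F.law.restrict {v | F.cdf v < 1} =
      (volume.restrict {v | F.cdf v < 1}).withDensity (fun v => ENNReal.ofReal (f v)) ∧
    MonotoneOn (fun v => f v / (1 - F.cdf v)) {v | F.cdf v < 1}

/-- First-order stochastic dominance of `F₁` over `F₂`. -/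
def Dominates (F₁ F₂ : Dist) : Prop := ∀ v : ℝ, F₁.cdf v ≤ F₂.cdf v

/-- Optimal posted-price revenue: a buyer facing the price `v` buys if and only if her value is at
least `v`. -/
def OPT (F : Dist) : ℝ := ⨆ v : ℝ, v * F.law.real (Set.Ici v)

/-- The expectation of `g` under `F` as an extended real number, the integral of the positive part
minus the integral of the negative part. -/
def expect (F : Dist) (g : ℝ → ℝ) : EReal :=
  ((∫⁻ s, ENNReal.ofReal (g s) ∂F.law : ENNReal) : EReal) -
    ((∫⁻ s, ENNReal.ofReal (-g s) ∂F.law : ENNReal) : EReal)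

/-- Pricing rules: the payment as a function of the sample and of the reported distribution. -/
abbrev PricingRule : Type := ℝ → Dist → ℝ

/-- Proper pricing rules: all expected payments are well defined, with values in `(-∞, ∞]`, and
truthful reporting of the distribution minimizes the expected payment. -/
structure IsProper (h : PricingRule) : Prop where
  measurable : ∀ F' : Dist, Measurable fun s => h s F'
  negPart : ∀ F F' : Dist, ∫⁻ s, ENNReal.ofReal (-h s F') ∂F.law ≠ ⊤
  truthful : ∀ F F' : Dist, expect F (fun s => h s F) ≤ expect F (fun s => h s F')

/-- The posted pricing policy induced by a pricing rule: the expected payment of a truthful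
buyer. -/
def policy (h : PricingRule) (F : Dist) : EReal := expect F fun s => h s F

/-- Pricing policies that are monotone in first-order stochastic dominance. -/
def IsMonotonePolicy (p : Dist → EReal) : Prop :=
  ∀ F₁ F₂ : Dist, Dominates F₁ F₂ → p F₂ ≤ p F₁

/-- Direct mechanisms: allocation `x` and payment `t` as functions of the sample, the reported
value and the reported distribution. -/
structure Mechanism where
  x : ℝ → ℝ → Dist → ℝ
  t : ℝ → ℝ → Dist → ℝ

open Classical in
/-- The hidden pricing mechanism of a pricing rule: the buyer participates if and only if her value
is at least the expected payment, and then pays according to the rule. -/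
def hiddenPricing (h : PricingRule) : Mechanism where
  x := fun _ v F => if policy h F ≤ (v : EReal) then 1 else 0
  t := fun s v F => (if policy h F ≤ (v : EReal) then 1 else 0) * h s F

/-- Expected revenue of a mechanism when the sample and the value are independent draws from `F`
and the buyer reports truthfully. -/
def Mechanism.revenue (M : Mechanism) (F : Dist) : ℝ :=
  ∫ z : ℝ × ℝ, M.t z.1 z.2 F ∂(F.law.prod F.law)

/-- The approximation ratio of a mechanism over the MHR distributions (the distribution
concentrated at `0`, whose optimal revenue vanishes, is left out).  The infimum is taken in the
extended reals. -/
def approxRatio (M : Mechanism) : EReal :=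
  ⨅ (F : Dist) (_ : IsMHR F) (_ : 0 < OPT F), ((M.revenue F / OPT F : ℝ) : EReal)

/-- Monotone hidden pricing mechanisms. -/
def IsMonotoneHiddenPricing (M : Mechanism) : Prop :=
  ∃ h : PricingRule, IsProper h ∧ IsMonotonePolicy (policy h) ∧ M = hiddenPricing h

end HiddenPricing

end

/-!
A hidden pricing mechanism with a proper pricing rule earns what its pricing policy earns as a
posted price (`revenue_of_policy_eq_coe`), and a distribution with monotone hazard rate has a
log-concave survival function: it lies above the exponential function through its values at `0` and
at a chosen point (`IsMHR.exp_le_surv`), and below an exponential function touching it at a chosen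
point (`IsMHR.exists_supporting`). Hence truncated exponential distributions are the extremal ones
among those dominated by a given distribution, and shifted exponential distributions are extremal in
the other direction.

**Reduction to payment functions.** Call a nondecreasing payment function `g` admissible for the
share `Γ` if its expectation under each truncated exponential distribution is at least every price
below the optimal one that earns less than the share `Γ` there (`IsAdmissible`). The share `Γ` is
feasible if each distribution with monotone hazard rate has an admissible payment function that
costs at most some price earning the share `Γ` (`Feasible`). If `Γ` is feasible, taking the cheapest
admissible payment function for each distribution gives a proper pricing rule with a monotone
policy, and it guarantees `Γ` (`exists_mechanism_of_feasible`): its price is not too high by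
feasibility, and not too low because the distribution dominates a truncated exponential one whose
optimal revenue is nearly the same (`IsAdmissible.le_rev`). Conversely, properness and monotonicity
make the monotone envelope of each payment function of a mechanism with ratio at least `Γ`
admissible (`policy_le_lintegral_lowerEnvelope`), so that `Γ` is feasible
(`feasible_of_le_approxRatio`).

**Existence of an optimum.** By Helly's selection theorem and Fatou's lemma, admissible payment
functions can be chosen to converge, so the set of feasible shares is closed
(`Feasible.of_tendsto`) and the cheapest admissible payment function exists
(`exists_admissible_minimizer`).

**Lower bound.** For the share `0.79`, piecewise linear payment functions with two kinks suffice
(`isAdmissible_hingePayment`). Their expectation depends on the survival function only through its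
integrals over two half-lines, which are bounded by those of the supporting exponential function at
the last price that earns the share (`feasible_lower`).

**Upper bound.** For the share `0.796`, consider the shifted exponential distribution starting at
`1.75`, for which every price earning the share is below `2.214`. Averaging the bounds for the
expected payments under truncated exponential distributions over the truncation point, with the
bounds for point masses and monotonicity in addition, every admissible payment function costs more
than that (`IsAdmissible.le_lintegral_exp`, `not_feasible_upper`).
-/

noncomputable section

namespace HiddenPricing

open MeasureTheory Filter Topology Set
open scoped ENNReal

/-! ### Survival functions, revenue curves and stochastic dominance -/

/-- The survival function `v ↦ P(V ≥ v)`, the probability of a sale at the price `v`. -/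
def surv (F : Dist) (v : ℝ) : ℝ := F.law.real (Ici v)

/-- The revenue curve: the expected revenue from posting the price `v`. -/
def rev (F : Dist) (v : ℝ) : ℝ := v * surv F v

lemma surv_nonneg (F : Dist) (v : ℝ) : 0 ≤ surv F v := measureReal_nonneg

lemma surv_le_one (F : Dist) (v : ℝ) : surv F v ≤ 1 := measureReal_le_one

lemma surv_antitone (F : Dist) : Antitone (surv F) := fun _ _ h =>
  measureReal_mono (Ici_subset_Ici.2 h)

lemma measure_Ici (F : Dist) (v : ℝ) : F.law (Ici v) = ENNReal.ofReal (surv F v) := by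
  simp [surv, measureReal_def]

lemma measure_Iio_zero (F : Dist) : F.law (Iio 0) = 0 := F.2.2

lemma surv_eq_one_sub (F : Dist) (v : ℝ) : surv F v = 1 - F.law.real (Iio v) := by
  have := probReal_compl_eq_one_sub (μ := F.law) (measurableSet_Iio (a := v))
  rw [compl_Iio] at this
  exact this

lemma surv_of_nonpos (F : Dist) {v : ℝ} (hv : v ≤ 0) : surv F v = 1 := by
  rw [surv_eq_one_sub, measureReal_def,
    measure_mono_null (Iio_subset_Iio hv) (measure_Iio_zero F)]
  simp

lemma cdf_eq (F : Dist) (v : ℝ) : F.cdf v = F.law.real (Iic v) :=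
  ProbabilityTheory.cdf_eq_real _ _

lemma one_sub_cdf (F : Dist) (v : ℝ) : 1 - F.cdf v = F.law.real (Ioi v) := by
  rw [cdf_eq, ← compl_Iic, probReal_compl_eq_one_sub measurableSet_Iic]

lemma one_sub_cdf_le_surv (F : Dist) (v : ℝ) : 1 - F.cdf v ≤ surv F v := by
  rw [one_sub_cdf]
  exact measureReal_mono Ioi_subset_Ici_self

lemma surv_le_one_sub_cdf (F : Dist) {v w : ℝ} (h : v < w) : surv F w ≤ 1 - F.cdf v := by
  rw [one_sub_cdf]
  exact measureReal_mono (Ici_subset_Ioi.2 h)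

/-- The survival function is left-continuous. -/
lemma exists_surv_lt_add (F : Dist) (v : ℝ) {ε : ℝ} (hε : 0 < ε) :
    ∃ w < v, surv F w < surv F v + ε := by
  have hU : (⋃ n : ℕ, Iio (v - 1 / ((n : ℝ) + 1))) = Iio v := by
    ext x
    simp only [mem_iUnion, mem_Iio]
    constructor
    · rintro ⟨n, hn⟩
      have : 0 < 1 / ((n : ℝ) + 1) := by positivity
      linarith
    · intro hx
      obtain ⟨n, hn⟩ := exists_nat_one_div_lt (sub_pos.2 hx)
      exact ⟨n, by linarith⟩
  have hm : Monotone fun n : ℕ => Iio (v - 1 / ((n : ℝ) + 1)) := by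
    intro a b hab
    apply Iio_subset_Iio
    have := Nat.one_div_le_one_div (α := ℝ) hab
    linarith
  have ht := tendsto_measure_iUnion_atTop (μ := F.law) hm
  rw [hU] at ht
  have ht' := (ENNReal.tendsto_toReal (measure_ne_top F.law (Iio v))).comp ht
  have hev := ht'.eventually (lt_mem_nhds (sub_lt_self ((F.law (Iio v)).toReal) hε))
  obtain ⟨n, hn⟩ := hev.exists
  have hn0 : 0 < 1 / ((n : ℝ) + 1) := by positivity
  refine ⟨v - 1 / ((n : ℝ) + 1), by linarith, ?_⟩
  rw [surv_eq_one_sub, surv_eq_one_sub]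
  simp only [measureReal_def]
  simp only [Function.comp] at hn
  linarith

lemma tendsto_measure_Ici_add (μ : Measure ℝ) (v : ℝ) :
    Tendsto (fun n : ℕ => μ (Ici (v + 1 / ((n : ℝ) + 1)))) atTop (𝓝 (μ (Ioi v))) := by
  have hU : (⋃ n : ℕ, Ici (v + 1 / ((n : ℝ) + 1))) = Ioi v := by
    ext x
    simp only [mem_iUnion, mem_Ici, mem_Ioi]
    constructor
    · rintro ⟨n, hn⟩
      have : 0 < 1 / ((n : ℝ) + 1) := by positivity
      linarith
    · intro hx
      obtain ⟨n, hn⟩ := exists_nat_one_div_lt (sub_pos.2 hx)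
      exact ⟨n, by linarith⟩
  have hm : Monotone fun n : ℕ => Ici (v + 1 / ((n : ℝ) + 1)) := by
    intro a b hab
    apply Ici_subset_Ici.2
    have := Nat.one_div_le_one_div (α := ℝ) hab
    linarith
  rw [← hU]
  exact tendsto_measure_iUnion_atTop hm

lemma exists_cdf_lt_add (F : Dist) (v : ℝ) {ε : ℝ} (hε : 0 < ε) :
    ∃ w > v, 1 - F.cdf v < surv F w + ε := by
  have ht := (ENNReal.tendsto_toReal (measure_ne_top F.law (Ioi v))).comp
    (tendsto_measure_Ici_add F.law v)
  have hev := ht.eventually (lt_mem_nhds (sub_lt_self ((F.law (Ioi v)).toReal) hε))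
  obtain ⟨n, hn⟩ := hev.exists
  have hn0 : 0 < 1 / ((n : ℝ) + 1) := by positivity
  refine ⟨v + 1 / ((n : ℝ) + 1), by linarith, ?_⟩
  rw [one_sub_cdf]
  simp only [surv, measureReal_def]
  simp only [Function.comp] at hn
  linarith

lemma Dominates.surv_le {F₁ F₂ : Dist} (h : Dominates F₁ F₂) (v : ℝ) :
    surv F₂ v ≤ surv F₁ v := by
  refine le_of_forall_pos_le_add fun ε hε => ?_
  obtain ⟨w, hw, h1⟩ := exists_surv_lt_add F₁ v hε
  have h2 := surv_le_one_sub_cdf F₂ hw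
  have h3 := one_sub_cdf_le_surv F₁ w
  have h4 := h w
  linarith

lemma dominates_of_surv_le {F₁ F₂ : Dist} (h : ∀ v, surv F₂ v ≤ surv F₁ v) :
    Dominates F₁ F₂ := by
  intro v
  refine le_of_forall_pos_le_add fun ε hε => ?_
  obtain ⟨w, hw, h1⟩ := exists_cdf_lt_add F₂ v hε
  have h2 := surv_le_one_sub_cdf F₁ hw
  have h4 := h w
  linarith

/-- Comparing the measures of half-lines suffices to compare those of all upper sets. -/
lemma measure_le_of_isUpperSet {μ ν : Measure ℝ} [IsProbabilityMeasure μ]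
    [IsProbabilityMeasure ν] (h : ∀ c, μ (Ici c) ≤ ν (Ici c)) {A : Set ℝ} (hA : IsUpperSet A) :
    μ A ≤ ν A := by
  have hIoi : ∀ v, μ (Ioi v) ≤ ν (Ioi v) := fun v =>
    le_of_tendsto_of_tendsto' (tendsto_measure_Ici_add μ v) (tendsto_measure_Ici_add ν v)
      fun n => h _
  rcases A.eq_empty_or_nonempty with rfl | hne
  · simp
  by_cases hb : BddBelow A
  · by_cases hm : sInf A ∈ A
    · have : A = Ici (sInf A) := by
        ext x
        exact ⟨fun hx => csInf_le hb hx, fun hx => hA hx hm⟩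
      rw [this]
      exact h _
    · have : A = Ioi (sInf A) := by
        ext x
        constructor
        · intro hx
          exact lt_of_le_of_ne (csInf_le hb hx) fun e => hm (e ▸ hx)
        · intro hx
          obtain ⟨y, hy, hyx⟩ := exists_lt_of_csInf_lt hne hx
          exact hA hyx.le hy
      rw [this]
      exact hIoi _
  · have : A = univ := by
      ext x
      simp only [mem_univ, iff_true]
      rw [not_bddBelow_iff] at hb
      obtain ⟨y, hy, hyx⟩ := hb x
      exact hA hyx.le hy
    simp [this]

/-- First-order stochastic dominance increases the expectation of monotone functions. -/
lemma lintegral_le_of_measure_Ici_le {μ ν : Measure ℝ} [IsProbabilityMeasure μ]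
    [IsProbabilityMeasure ν] (h : ∀ c, μ (Ici c) ≤ ν (Ici c)) {g : ℝ → ℝ≥0∞}
    (hg : Monotone g) : ∫⁻ s, g s ∂μ ≤ ∫⁻ s, g s ∂ν := by
  have hgm : ∀ n : ℕ, Monotone fun s => min (g s) n := fun n s t hst =>
    min_le_min_right _ (hg hst)
  have key : ∀ n : ℕ, ∫⁻ s, min (g s) n ∂μ ≤ ∫⁻ s, min (g s) n ∂ν := by
    intro n
    have hfin : ∀ s, min (g s) n ≠ ⊤ := fun s =>
      ne_top_of_le_ne_top (ENNReal.natCast_ne_top n) (min_le_right _ _)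
    have hmono : Monotone fun s => (min (g s) n).toReal := fun s t hst =>
      ENNReal.toReal_mono (hfin t) (hgm n hst)
    have e : ∀ ρ : Measure ℝ, ∫⁻ s, min (g s) n ∂ρ =
        ∫⁻ t in Ioi (0 : ℝ), ρ {s | t ≤ (min (g s) n).toReal} := by
      intro ρ
      rw [← lintegral_eq_lintegral_meas_le ρ (Eventually.of_forall fun s => ENNReal.toReal_nonneg)
        hmono.measurable.aemeasurable]
      exact lintegral_congr fun s => (ENNReal.ofReal_toReal (hfin s)).symm
    rw [e, e]
    refine lintegral_mono fun t => measure_le_of_isUpperSet h ?_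
    intro a b hab ha
    exact le_trans ha (hmono hab)
  have hsup : ∀ s, g s = ⨆ n : ℕ, min (g s) n := by
    intro s
    rw [← inf_iSup_eq, ENNReal.iSup_natCast]
    simp
  have hl : ∀ ρ : Measure ℝ, ∫⁻ s, g s ∂ρ = ⨆ n : ℕ, ∫⁻ s, min (g s) n ∂ρ := by
    intro ρ
    rw [← lintegral_iSup (fun n => (hgm n).measurable)]
    · exact lintegral_congr hsup
    · intro a b hab s
      exact min_le_min_left _ (by exact_mod_cast hab)
  rw [hl, hl]
  exact iSup_mono key

lemma Dominates.lintegral_le {F₁ F₂ : Dist} (h : Dominates F₁ F₂) {g : ℝ → ℝ≥0∞}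
    (hg : Monotone g) : ∫⁻ s, g s ∂F₂.law ≤ ∫⁻ s, g s ∂F₁.law := by
  refine lintegral_le_of_measure_Ici_le (fun c => ?_) hg
  rw [measure_Ici, measure_Ici]
  exact ENNReal.ofReal_le_ofReal (h.surv_le c)

lemma exists_lt_rev {F : Dist} {x : ℝ} (h : x < OPT F) : ∃ v, x < rev F v :=
  exists_lt_of_lt_ciSup h

lemma rev_nonneg (F : Dist) {v : ℝ} (hv : 0 ≤ v) : 0 ≤ rev F v := mul_nonneg hv (surv_nonneg F v)

lemma pos_of_rev_pos {F : Dist} {v : ℝ} (h : 0 < rev F v) : 0 < v :=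
  pos_of_mul_pos_left h (surv_nonneg F v)

lemma surv_pos_of_rev_pos {F : Dist} {v : ℝ} (h : 0 < rev F v) : 0 < surv F v :=
  pos_of_mul_pos_right h (pos_of_rev_pos h).le

/-! ### Expectations and revenues -/

lemma expect_of_nonneg {F : Dist} {g : ℝ → ℝ} (hg : ∀ᵐ s ∂F.law, 0 ≤ g s) :
    expect F g = ((∫⁻ s, ENNReal.ofReal (g s) ∂F.law : ℝ≥0∞) : EReal) := by
  have : ∫⁻ s, ENNReal.ofReal (-g s) ∂F.law = 0 := by
    rw [lintegral_congr_ae (g := fun _ => 0)]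
    · simp
    · filter_upwards [hg] with s hs
      simpa using hs
  simp [expect, this]

lemma expect_eq_integral {F : Dist} {g : ℝ → ℝ} (hm : Measurable g)
    (hp : ∫⁻ s, ENNReal.ofReal (g s) ∂F.law ≠ ⊤)
    (hn : ∫⁻ s, ENNReal.ofReal (-g s) ∂F.law ≠ ⊤) :
    expect F g = ((∫ s, g s ∂F.law : ℝ) : EReal) := by
  have hi : Integrable g F.law := by
    refine ⟨hm.aestronglyMeasurable, ?_⟩
    rw [hasFiniteIntegral_iff_norm]
    have : ∀ s, ENNReal.ofReal ‖g s‖ = ENNReal.ofReal (g s) + ENNReal.ofReal (-g s) := by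
      intro s
      rcases le_total 0 (g s) with h | h
      · rw [Real.norm_of_nonneg h, ENNReal.ofReal_of_nonpos (p := -g s) (by linarith), add_zero]
      · rw [Real.norm_of_nonpos h, ENNReal.ofReal_of_nonpos h, zero_add]
    rw [lintegral_congr this, lintegral_add_left hm.ennreal_ofReal]
    exact ENNReal.add_lt_top.2 ⟨hp.lt_top, hn.lt_top⟩
  rw [integral_eq_lintegral_pos_part_sub_lintegral_neg_part hi, expect, EReal.coe_sub]
  congr 1
  · exact (EReal.coe_ennreal_toReal hp).symm
  · exact (EReal.coe_ennreal_toReal hn).symm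

open Classical in
/-- The revenue of a hidden pricing mechanism factorizes, since sample and value are
independent. -/
lemma revenue_hiddenPricing (h : PricingRule) (F : Dist) :
    (hiddenPricing h).revenue F =
      (∫ s, h s F ∂F.law) * F.law.real {v : ℝ | policy h F ≤ (v : EReal)} := by
  have hms : MeasurableSet {v : ℝ | policy h F ≤ (v : EReal)} :=
    measurableSet_le measurable_const measurable_coe_real_ereal
  have e : ∀ z : ℝ × ℝ, (hiddenPricing h).t z.1 z.2 F =
      h z.1 F * ({v : ℝ | policy h F ≤ (v : EReal)}.indicator 1 z.2) := by
    intro z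
    simp only [hiddenPricing, indicator_apply, mem_ofPred_eq, Pi.one_apply]
    rw [mul_comm]
  simp only [Mechanism.revenue, e]
  rw [integral_prod_mul (L := ℝ) (fun s => h s F)
    ({v : ℝ | policy h F ≤ (v : EReal)}.indicator 1), integral_indicator_one hms]

lemma revenue_of_policy_eq_top {h : PricingRule} {F : Dist} (hp : policy h F = ⊤) :
    (hiddenPricing h).revenue F = 0 := by
  rw [revenue_hiddenPricing]
  simp [hp]

/-- A hidden pricing mechanism with a finite expected payment earns what posting this payment as a
price earns. -/
lemma revenue_of_policy_eq_coe {h : PricingRule} (hh : IsProper h) {F : Dist} {p : ℝ}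
    (hp : policy h F = p) : (hiddenPricing h).revenue F = rev F p := by
  have hfin : ∫⁻ s, ENNReal.ofReal (h s F) ∂F.law ≠ ⊤ := by
    intro htop
    have : policy h F = ⊤ := by
      rw [policy, expect, htop, ← EReal.coe_ennreal_toReal (hh.negPart F F)]
      exact EReal.top_sub_coe _
    rw [hp] at this
    exact EReal.coe_ne_top _ this
  have e := expect_eq_integral (hh.measurable F) hfin (hh.negPart F F)
  have : policy h F = ((∫ s, h s F ∂F.law : ℝ) : EReal) := e
  rw [hp, EReal.coe_eq_coe_iff] at this
  rw [revenue_hiddenPricing, ← this, rev, surv, hp]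
  congr 2
  ext v
  simp

lemma policy_ne_bot {h : PricingRule} (hh : IsProper h) (F : Dist) : policy h F ≠ ⊥ := by
  rw [policy, expect, ← EReal.coe_ennreal_toReal (hh.negPart F F)]
  generalize ∫⁻ s, ENNReal.ofReal (h s F) ∂F.law = x
  induction x with
  | top => simp
  | coe x =>
    rw [← EReal.coe_ennreal_toReal ENNReal.coe_ne_top, ← EReal.coe_sub]
    exact EReal.coe_ne_bot _

/-! ### Log-concavity of survival functions with monotone hazard rate -/

/-- If `S` loses, on each subinterval, at most the proportion `c` of its value at the left end per
unit of length, then it decreases at most like `exp (-c v)`. -/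
lemma mul_exp_neg_le_of_sub_le {S : ℝ → ℝ} {x y c : ℝ} (hxy : x ≤ y)
    (h : ∀ u w, x ≤ u → u ≤ w → w ≤ y → S u - S w ≤ c * (w - u) * S u) :
    S x * Real.exp (-(c * (y - x))) ≤ S y := by
  have ht : Tendsto (fun n : ℕ => S x * (1 + (-(c * (y - x))) / n) ^ n) atTop
      (𝓝 (S x * Real.exp (-(c * (y - x))))) :=
    (Real.tendsto_one_add_div_pow_exp (-(c * (y - x)))).const_mul _
  refine le_of_tendsto ht ?_
  obtain ⟨N, hN⟩ := exists_nat_gt (c * (y - x))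
  filter_upwards [eventually_ge_atTop (max N 1)] with n hn
  have hn1 : (1 : ℝ) ≤ n := by exact_mod_cast (le_max_right N 1).trans hn
  have hnN : c * (y - x) < n := hN.trans_le (by exact_mod_cast (le_max_left N 1).trans hn)
  set r : ℝ := (y - x) / n with hr
  have hr0 : 0 ≤ r := div_nonneg (by linarith) (by linarith)
  have hnr : n * r = y - x := by rw [hr]; field_simp
  have hq : 0 ≤ 1 - c * r := by
    have : c * r < 1 := by rw [hr, ← mul_div_assoc, div_lt_one (by linarith)]; exact hnN
    linarith
  have e : 1 + (-(c * (y - x))) / (n : ℝ) = 1 - c * r := by rw [hr]; ring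
  rw [e]
  have step : ∀ k : ℕ, k ≤ n → S x * (1 - c * r) ^ k ≤ S (x + k * r) := by
    intro k
    induction k with
    | zero => intro _; simp
    | succ k ih =>
      intro hk
      have hk' : ((k : ℝ) + 1) ≤ n := by exact_mod_cast hk
      have h1 := ih (by omega)
      have h2 := h (x + k * r) (x + (k + 1) * r) (by
        have : 0 ≤ (k : ℝ) * r := by positivity
        linarith) (by nlinarith) (by nlinarith)
      have h3 : S (x + k * r) * (1 - c * r) ≤ S (x + (k + 1) * r) := by
        have : c * ((x + (k + 1) * r) - (x + k * r)) * S (x + k * r) =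
          c * r * S (x + k * r) := by ring
        rw [this] at h2
        linarith
      push_cast
      calc S x * (1 - c * r) ^ (k + 1) = (S x * (1 - c * r) ^ k) * (1 - c * r) := by ring
        _ ≤ S (x + k * r) * (1 - c * r) := mul_le_mul_of_nonneg_right h1 hq
        _ ≤ _ := h3
  have := step n le_rfl
  rwa [hnr, add_sub_cancel] at this

/-- If `S` loses, on each subinterval, at least the proportion `c` of its value at the right end
per unit of length, then it decreases at least like `exp (-c v)`. -/
lemma mul_exp_le_of_le_sub {S : ℝ → ℝ} {x y c : ℝ} (hxy : x ≤ y) (hc : 0 ≤ c)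
    (h : ∀ u w, x ≤ u → u ≤ w → w ≤ y → c * (w - u) * S w ≤ S u - S w) :
    S y * Real.exp (c * (y - x)) ≤ S x := by
  have ht : Tendsto (fun n : ℕ => S y * (1 + (c * (y - x)) / n) ^ n) atTop
      (𝓝 (S y * Real.exp (c * (y - x)))) :=
    (Real.tendsto_one_add_div_pow_exp (c * (y - x))).const_mul _
  refine le_of_tendsto ht ?_
  filter_upwards [eventually_ge_atTop 1] with n hn
  have hn1 : (1 : ℝ) ≤ n := by exact_mod_cast hn
  set r : ℝ := (y - x) / n with hr
  have hr0 : 0 ≤ r := div_nonneg (by linarith) (by linarith)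
  have hnr : n * r = y - x := by rw [hr]; field_simp
  have hq : 0 ≤ 1 + c * r := by positivity
  have e : 1 + (c * (y - x)) / (n : ℝ) = 1 + c * r := by rw [hr]; ring
  rw [e]
  have step : ∀ k : ℕ, k ≤ n → S y * (1 + c * r) ^ k ≤ S (y - k * r) := by
    intro k
    induction k with
    | zero => intro _; simp
    | succ k ih =>
      intro hk
      have hk' : ((k : ℝ) + 1) ≤ n := by exact_mod_cast hk
      have h1 := ih (by omega)
      have h2 := h (y - (k + 1) * r) (y - k * r) (by nlinarith) (by nlinarith) (by
        have : 0 ≤ (k : ℝ) * r := by positivity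
        linarith)
      have h3 : S (y - k * r) * (1 + c * r) ≤ S (y - (k + 1) * r) := by
        have : c * ((y - k * r) - (y - (k + 1) * r)) * S (y - k * r) =
          c * r * S (y - k * r) := by ring
        rw [this] at h2
        linarith
      push_cast
      calc S y * (1 + c * r) ^ (k + 1) = (S y * (1 + c * r) ^ k) * (1 + c * r) := by ring
        _ ≤ S (y - k * r) * (1 + c * r) := mul_le_mul_of_nonneg_right h1 hq
        _ ≤ _ := h3
  have := step n le_rfl
  rwa [hnr, sub_sub_cancel] at this

lemma cdf_mono (F : Dist) : Monotone F.cdf := ProbabilityTheory.monotone_cdf _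

lemma surv_sub_surv (F : Dist) {u w : ℝ} (h : u ≤ w) :
    surv F u - surv F w = F.law.real (Ico u w) := by
  rw [surv, surv, ← measureReal_sdiff (Ici_subset_Ici.2 h) measurableSet_Ici]
  congr 1
  ext x
  simp

/-- The survival function of a distribution with monotone hazard rate lies below an exponential
function that touches it at a given point: it is log-concave. -/
lemma IsMHR.exists_supporting {F : Dist} (hF : IsMHR F) {y : ℝ} (hy : F.cdf y < 1) :
    ∃ c : ℝ, 0 ≤ c ∧ ∀ v, surv F v ≤ surv F y * Real.exp (-(c * (v - y))) := by
  obtain ⟨f, hf0, hden, hmono⟩ := hF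
  set A : Set ℝ := {v | F.cdf v < 1} with hA
  have hAm : MeasurableSet A := measurableSet_lt (cdf_mono F).measurable measurable_const
  have hlow : ∀ {u w}, u ≤ w → w ∈ A → u ∈ A := fun huw hw => (cdf_mono F huw).trans_lt hw
  -- inside `A` there are no atoms
  have hatom : ∀ v ∈ A, surv F v = 1 - F.cdf v := by
    intro v hv
    have h0 : F.law {v} = 0 := by
      have h1 : F.law.restrict A {v} = F.law {v} := by
        rw [Measure.restrict_apply (measurableSet_singleton v)]
        congr 1
        ext x
        simp only [mem_inter_iff, mem_singleton_iff]
        exact ⟨fun h => h.1, fun h => ⟨h, h ▸ hv⟩⟩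
      rw [← h1, hden]
      exact (withDensity_absolutelyContinuous _ _)
        ((Measure.absolutelyContinuous_of_le Measure.restrict_le_self) (by simp))
    rw [one_sub_cdf, surv, ← Ioi_insert, measureReal_def, measureReal_def]
    congr 1
    apply le_antisymm
    · calc F.law (insert v (Ioi v)) ≤ F.law {v} + F.law (Ioi v) := by
            rw [insert_eq]; exact measure_union_le _ _
        _ = _ := by rw [h0, zero_add]
    · exact measure_mono (subset_insert _ _)
  have hIco : ∀ u w, w ∈ A → F.law (Ico u w) = ∫⁻ v in Ico u w, ENNReal.ofReal (f v) := by
    intro u w hw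
    have hsub : Ico u w ⊆ A := fun x hx => hlow hx.2.le hw
    have h1 : F.law.restrict A (Ico u w) = F.law (Ico u w) := by
      rw [Measure.restrict_apply measurableSet_Ico, inter_eq_left.2 hsub]
    rw [← h1, hden, withDensity_apply _ measurableSet_Ico,
      Measure.restrict_restrict measurableSet_Ico, inter_eq_left.2 hsub]
  have hfeq : ∀ v ∈ A, f v = f v / (1 - F.cdf v) * surv F v := by
    intro v hv
    have : 1 - F.cdf v ≠ 0 := (sub_pos.2 hv).ne'
    rw [hatom v hv]
    field_simp
  set c := f y / (1 - F.cdf y) with hc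
  have hc0 : 0 ≤ c := div_nonneg (hf0 y) (sub_pos.2 hy).le
  -- to the left of `y` the hazard rate is at most `c`
  have hleft : ∀ u w, u ≤ w → w ≤ y → surv F u - surv F w ≤ c * (w - u) * surv F u := by
    intro u w huw hwy
    rw [surv_sub_surv F huw, measureReal_def, hIco u w (hlow hwy hy)]
    have : ∫⁻ v in Ico u w, ENNReal.ofReal (f v) ≤
        ∫⁻ _ in Ico u w, ENNReal.ofReal (c * surv F u) := by
      refine setLIntegral_mono measurable_const fun v hv => ENNReal.ofReal_le_ofReal ?_
      have hvA : v ∈ A := hlow (hv.2.le.trans hwy) hy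
      rw [hfeq v hvA]
      exact mul_le_mul (hmono hvA hy (hv.2.le.trans hwy)) (surv_antitone F hv.1)
        (surv_nonneg _ _) hc0
    rw [lintegral_const, Measure.restrict_apply_univ, Real.volume_Ico,
      ← ENNReal.ofReal_mul (mul_nonneg hc0 (surv_nonneg _ _))] at this
    refine (ENNReal.toReal_le_of_le_ofReal ?_ this).trans (le_of_eq (by ring))
    exact mul_nonneg (mul_nonneg hc0 (surv_nonneg _ _)) (by linarith)
  -- to the right of `y` the hazard rate is at least `c`
  have hright : ∀ u w, y ≤ u → u ≤ w → w ∈ A → c * (w - u) * surv F w ≤ surv F u - surv F w := by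
    intro u w hyu huw hw
    rw [surv_sub_surv F huw, measureReal_def]
    have : ∫⁻ _ in Ico u w, ENNReal.ofReal (c * surv F w) ≤
        ∫⁻ v in Ico u w, ENNReal.ofReal (f v) := by
      refine setLIntegral_mono' measurableSet_Ico fun v hv => ENNReal.ofReal_le_ofReal ?_
      have hvA : v ∈ A := hlow hv.2.le hw
      rw [hfeq v hvA]
      exact mul_le_mul (hmono hy hvA (hyu.trans hv.1)) (surv_antitone F hv.2.le)
        (surv_nonneg _ _) (hc0.trans (hmono hy hvA (hyu.trans hv.1)))
    rw [← hIco u w hw, lintegral_const, Measure.restrict_apply_univ, Real.volume_Ico,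
      ← ENNReal.ofReal_mul (mul_nonneg hc0 (surv_nonneg _ _))] at this
    rw [ENNReal.ofReal_le_iff_le_toReal (measure_ne_top _ _)] at this
    exact (le_of_eq (by ring)).trans this
  have hin : ∀ v ∈ A, surv F v ≤ surv F y * Real.exp (-(c * (v - y))) := by
    intro v hv
    rcases le_total v y with h | h
    · have := mul_exp_neg_le_of_sub_le (S := surv F) (c := c) h
        fun u w _ huw hw => hleft u w huw hw
      calc surv F v = surv F v * Real.exp (-(c * (y - v))) * Real.exp (-(c * (v - y))) := by
            rw [mul_assoc, ← Real.exp_add]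
            ring_nf
            simp
        _ ≤ _ := mul_le_mul_of_nonneg_right this (Real.exp_pos _).le
    · have := mul_exp_le_of_le_sub (S := surv F) h hc0
        fun u w hu huw hw => hright u w hu huw (hlow hw hv)
      calc surv F v = surv F v * Real.exp (c * (v - y)) * Real.exp (-(c * (v - y))) := by
            rw [mul_assoc, ← Real.exp_add]
            ring_nf
            simp
        _ ≤ _ := mul_le_mul_of_nonneg_right this (Real.exp_pos _).le
  refine ⟨c, hc0, fun v => ?_⟩
  by_cases hv : v ∈ A
  · exact hin v hv
  · by_cases hw : ∃ w < v, w ∉ A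
    · obtain ⟨w, hwv, hwA⟩ := hw
      have h1 := surv_le_one_sub_cdf F hwv
      have h2 : 1 ≤ F.cdf w := not_lt.1 hwA
      exact (by linarith : surv F v ≤ 0).trans
        (mul_nonneg (surv_nonneg _ _) (Real.exp_pos _).le)
    · push Not at hw
      have hcont : Tendsto (fun w => surv F y * Real.exp (-(c * (w - y)))) (𝓝[<] v)
          (𝓝 (surv F y * Real.exp (-(c * (v - y))))) := by
        have : Continuous fun w => surv F y * Real.exp (-(c * (w - y))) := by fun_prop
        exact this.continuousAt.continuousWithinAt
      refine ge_of_tendsto hcont ?_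
      filter_upwards [self_mem_nhdsWithin] with w hwv
      exact (surv_antitone F (le_of_lt hwv)).trans (hin w (hw w hwv))

lemma cdf_lt_one_of_surv_pos {F : Dist} {v w : ℝ} (h : v < w) (hw : 0 < surv F w) :
    F.cdf v < 1 := by
  have := surv_le_one_sub_cdf F h
  linarith

/-- The survival function lies above the exponential function through its values at `0` and
`r`. -/
lemma IsMHR.exp_le_surv {F : Dist} (hF : IsMHR F) {r v a : ℝ} (hr : 0 < r)
    (hvr : v ≤ r) (ha : surv F r = Real.exp (-(a * r))) (hv : 0 ≤ v) :
    Real.exp (-(a * v)) ≤ surv F v := by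
  rcases hvr.eq_or_lt with rfl | hlt
  · exact ha.ge
  have hSr : 0 < surv F r := by rw [ha]; exact Real.exp_pos _
  obtain ⟨c, hc, hs⟩ := hF.exists_supporting (cdf_lt_one_of_surv_pos hlt hSr)
  have hSv : 0 < surv F v := hSr.trans_le (surv_antitone F hvr)
  have h0 := hs 0
  have h1 := hs r
  rw [surv_of_nonpos F le_rfl] at h0
  rw [ha] at h1
  set x := Real.log (surv F v) with hx
  have hex : surv F v = Real.exp x := (Real.exp_log hSv).symm
  rw [hex, ← Real.exp_add] at h0 h1
  rw [hex]
  have h0' : 0 ≤ x + -(c * (0 - v)) := by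
    by_contra hneg
    push Not at hneg
    have := Real.exp_lt_one_iff.2 hneg
    linarith
  have h1' := Real.exp_le_exp.1 h1
  apply Real.exp_le_exp.2
  have h2 : 0 ≤ (r - v) * (x + c * v) := mul_nonneg (by linarith) (by linarith)
  nlinarith

/-- The revenue curve is quasi-concave. -/
lemma IsMHR.min_le_rev {F : Dist} (hF : IsMHR F) {r p v x : ℝ} (hr : 0 < r) (hrp : r ≤ p)
    (hpv : p ≤ v) (h1 : x ≤ rev F r) (h2 : x ≤ rev F v) : x ≤ rev F p := by
  rcases hpv.eq_or_lt with rfl | hlt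
  · exact h2
  rcases hrp.eq_or_lt with rfl | hrp'
  · exact h1
  by_contra hcon
  push Not at hcon
  have hp : 0 < p := hr.trans_le hrp
  have hv : 0 < v := hp.trans hlt
  have hSv : 0 < surv F v := by
    have : 0 < rev F v := (rev_nonneg F hp.le).trans_lt (hcon.trans_le h2)
    exact surv_pos_of_rev_pos this
  have hSp : 0 < surv F p := hSv.trans_le (surv_antitone F hpv)
  obtain ⟨c, hc, hs⟩ := hF.exists_supporting (cdf_lt_one_of_surv_pos hlt hSv)
  have e1 : p * surv F p < r * (surv F p * Real.exp (-(c * (r - p)))) :=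
    (hcon.trans_le h1).trans_le (mul_le_mul_of_nonneg_left (hs r) hr.le)
  have e2 : p * surv F p < v * (surv F p * Real.exp (-(c * (v - p)))) :=
    (hcon.trans_le h2).trans_le (mul_le_mul_of_nonneg_left (hs v) hv.le)
  have e1' : p / r < Real.exp (c * (p - r)) := by
    rw [div_lt_iff₀ hr]
    have : p * surv F p < (Real.exp (c * (p - r)) * r) * surv F p := by
      calc _ < _ := e1
        _ = _ := by ring_nf
    exact lt_of_mul_lt_mul_right this hSp.le
  have e2' : p * Real.exp (c * (v - p)) < v := by
    have h3 : p < v * Real.exp (-(c * (v - p))) := by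
      have : p * surv F p < (v * Real.exp (-(c * (v - p)))) * surv F p := by
        calc _ < _ := e2
          _ = _ := by ring_nf
      exact lt_of_mul_lt_mul_right this hSp.le
    calc p * Real.exp (c * (v - p)) <
        v * Real.exp (-(c * (v - p))) * Real.exp (c * (v - p)) :=
          mul_lt_mul_of_pos_right h3 (Real.exp_pos _)
      _ = v := by rw [mul_assoc, ← Real.exp_add]; simp
  -- comparing slopes of the logarithm: the first forces `c > 1 / p`, the second `c < 1 / p`
  have f1 : c * p < 1 := by
    have := Real.add_one_le_exp (c * (v - p))
    nlinarith
  have f2 : r / p ≤ Real.exp (-(c * (p - r))) → False := by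
    intro h3
    have : Real.exp (-(c * (p - r))) < r / p := by
      rw [Real.exp_neg, inv_lt_comm₀ (Real.exp_pos _) (by positivity), inv_div]
      exact e1'
    linarith
  apply f2
  have := Real.add_one_le_exp (-(c * (p - r)))
  refine le_trans ?_ this
  rw [div_le_iff₀ hp]
  nlinarith

/-- The revenue curve tends to `0`. -/
lemma IsMHR.eventually_rev_lt {F : Dist} (hF : IsMHR F) {ε : ℝ} (hε : 0 < ε) :
    ∃ C : ℝ, ∀ v, C ≤ v → rev F v < ε := by
  by_cases hy : ∃ y, surv F y < 1 ∧ F.cdf y < 1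
  · obtain ⟨y, hy1, hy2⟩ := hy
    obtain ⟨c, hc, hs⟩ := hF.exists_supporting hy2
    have hc' : 0 < c := by
      rcases hc.eq_or_lt with rfl | h
      · have := hs 0
        rw [surv_of_nonpos F le_rfl] at this
        simp at this
        linarith
      · exact h
    have ht : Tendsto (fun v : ℝ => surv F y * Real.exp (c * y) / c * ((c * v) ^ 1 *
        Real.exp (-(c * v)))) atTop (𝓝 (surv F y * Real.exp (c * y) / c * 0)) := by
      refine Tendsto.const_mul _ ?_
      exact (Real.tendsto_pow_mul_exp_neg_atTop_nhds_zero 1).comp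
        (tendsto_id.const_mul_atTop hc')
    rw [mul_zero] at ht
    obtain ⟨C, hC⟩ := eventually_atTop.1 (ht.eventually (gt_mem_nhds hε))
    refine ⟨max C 0, fun v hv => lt_of_le_of_lt ?_ (hC v ((le_max_left _ _).trans hv))⟩
    have hv0 : 0 ≤ v := (le_max_right _ _).trans hv
    calc rev F v ≤ v * (surv F y * Real.exp (-(c * (v - y)))) :=
          mul_le_mul_of_nonneg_left (hs v) hv0
      _ = _ := by
          rw [show -(c * (v - y)) = c * y + -(c * v) by ring, Real.exp_add]
          field_simp
  · push Not at hy
    -- the survival function drops from `1` to `0`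
    have : ∃ y, surv F y < 1 := by
      have ht : Tendsto (fun y : ℝ => F.cdf y) atTop (𝓝 1) := ProbabilityTheory.tendsto_cdf_atTop _
      obtain ⟨y, hy⟩ := (ht.eventually (lt_mem_nhds (show (0 : ℝ) < 1 by norm_num))).exists
      exact ⟨y + 1, by have := surv_le_one_sub_cdf F (lt_add_one y); linarith⟩
    obtain ⟨y, hy1⟩ := this
    have h1 := hy y hy1
    refine ⟨y + 1, fun v hv => ?_⟩
    have h2 := surv_le_one_sub_cdf F (show y < v by linarith)
    have h3 : surv F v = 0 := le_antisymm (by linarith) (surv_nonneg _ _)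
    simp [rev, h3, hε]

/-- A distribution with monotone hazard rate and positive optimal revenue has no atom at `0`. -/
lemma IsMHR.ae_pos {F : Dist} (hF : IsMHR F) (hO : 0 < OPT F) : ∀ᵐ s ∂F.law, 0 < s := by
  have h0 : F.cdf 0 < 1 := by
    by_contra h
    push Not at h
    obtain ⟨v, hv⟩ := exists_lt_rev hO
    have h1 := surv_le_one_sub_cdf F (pos_of_rev_pos hv)
    have h2 := surv_pos_of_rev_pos hv
    linarith
  obtain ⟨f, -, hden, -⟩ := hF
  have hs : F.law {0} = 0 := by
    have h1 : F.law.restrict {v | F.cdf v < 1} {0} = F.law {0} := by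
      rw [Measure.restrict_apply (measurableSet_singleton _)]
      congr 1
      ext x
      simp only [mem_inter_iff, mem_singleton_iff]
      exact ⟨fun h => h.1, fun h => ⟨h, h ▸ h0⟩⟩
    rw [← h1, hden]
    exact (withDensity_absolutelyContinuous _ _)
      ((Measure.absolutelyContinuous_of_le Measure.restrict_le_self) (by simp))
  rw [ae_iff]
  refine measure_mono_null (t := Iio 0 ∪ {0}) (fun x hx => ?_)
    (measure_union_null (measure_Iio_zero F) hs)
  rcases lt_or_eq_of_le (not_lt.1 hx) with h | h
  · exact Or.inl h
  · exact Or.inr h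

/-! ### Truncated exponential distributions -/

/-- The law of `min X B` for an exponential variable `X` with rate `c`: density `c exp (-c s)` on
`(0, B)` and an atom of mass `exp (-c B)` at `B`. For `c = 0` it is the point mass at `B`. -/
def truncExpMeasure (c B : ℝ) : Measure ℝ :=
  ENNReal.ofReal (Real.exp (-(c * B))) • Measure.dirac B +
    (volume.restrict (Ioo 0 B)).withDensity fun s => ENNReal.ofReal (c * Real.exp (-(c * s)))

lemma measurable_expDensity (c : ℝ) :
    Measurable fun s : ℝ => ENNReal.ofReal (c * Real.exp (-(c * s))) := by fun_prop

lemma lintegral_truncExp (c B : ℝ) {g : ℝ → ℝ≥0∞} (hg : Measurable g) :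
    ∫⁻ s, g s ∂truncExpMeasure c B = ENNReal.ofReal (Real.exp (-(c * B))) * g B +
      ∫⁻ s in Ioo 0 B, ENNReal.ofReal (c * Real.exp (-(c * s))) * g s := by
  rw [truncExpMeasure, lintegral_add_measure, lintegral_smul_measure, lintegral_dirac,
    lintegral_withDensity_eq_lintegral_mul _ (measurable_expDensity c) hg]
  rfl

lemma integral_expDensity (c u w : ℝ) :
    ∫ s in u..w, c * Real.exp (-(c * s)) = Real.exp (-(c * u)) - Real.exp (-(c * w)) := by
  have hd : ∀ s ∈ uIcc u w, HasDerivAt (fun s => -Real.exp (-(c * s)))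
      (c * Real.exp (-(c * s))) s := by
    intro s _
    have h1 : HasDerivAt (fun s => -(c * s)) (-(c * 1)) s := ((hasDerivAt_id s).const_mul c).neg
    exact h1.exp.neg.congr_deriv (by ring)
  rw [intervalIntegral.integral_eq_sub_of_hasDerivAt hd
    (Continuous.intervalIntegrable (by fun_prop) _ _)]
  ring

lemma lintegral_expDensity {c u w : ℝ} (hc : 0 ≤ c) (h : u ≤ w) :
    ∫⁻ s in Ioo u w, ENNReal.ofReal (c * Real.exp (-(c * s))) =
      ENNReal.ofReal (Real.exp (-(c * u)) - Real.exp (-(c * w))) := by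
  rw [← integral_expDensity, intervalIntegral.integral_of_le h, integral_Ioc_eq_integral_Ioo,
    ofReal_integral_eq_lintegral_ofReal]
  · exact ((Continuous.integrableOn_Icc (by fun_prop)).mono_set Ioo_subset_Icc_self)
  · exact Eventually.of_forall fun s => mul_nonneg hc (Real.exp_pos _).le

lemma truncExp_apply {c B : ℝ} (hc : 0 ≤ c) {A : Set ℝ} (hA : MeasurableSet A) {v : ℝ}
    (hvB : v ≤ B) (hB : B ∈ A) (h : (A ∩ Ioo 0 B : Set ℝ) =ᵐ[volume] Ioo v B) :
    truncExpMeasure c B A = ENNReal.ofReal (Real.exp (-(c * v))) := by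
  rw [truncExpMeasure, Measure.add_apply, Measure.smul_apply, Measure.dirac_apply' _ hA,
    withDensity_apply _ hA, Measure.restrict_restrict hA, Measure.restrict_congr_set h,
    lintegral_expDensity hc hvB, indicator_of_mem hB, Pi.one_apply, smul_eq_mul, mul_one,
    ← ENNReal.ofReal_add (Real.exp_pos _).le]
  · congr 1; ring
  · have : Real.exp (-(c * B)) ≤ Real.exp (-(c * v)) :=
      Real.exp_le_exp.2 (by nlinarith)
    linarith

lemma truncExp_Ioi {c B v : ℝ} (hc : 0 ≤ c) (hv : 0 ≤ v) (hvB : v < B) :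
    truncExpMeasure c B (Ioi v) = ENNReal.ofReal (Real.exp (-(c * v))) := by
  refine truncExp_apply hc measurableSet_Ioi hvB.le hvB (Eventually.of_forall fun x => ?_)
  apply propext
  constructor
  · exact fun h => ⟨h.1, h.2.2⟩
  · exact fun h => ⟨h.1, hv.trans_lt h.1, h.2⟩

lemma truncExp_Ici {c B v : ℝ} (hc : 0 ≤ c) (hv : 0 ≤ v) (hvB : v ≤ B) :
    truncExpMeasure c B (Ici v) = ENNReal.ofReal (Real.exp (-(c * v))) := by
  refine truncExp_apply hc measurableSet_Ici hvB hvB ?_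
  refine EventuallyEq.trans ?_ (EventuallyEq.refl _ (Ioo v B))
  have h1 : ∀ᵐ x : ℝ ∂volume, x ≠ v := by
    rw [ae_iff]
    simp
  filter_upwards [h1] with x hx
  apply propext
  constructor
  · exact fun h => ⟨lt_of_le_of_ne h.1 hx.symm, h.2.2⟩
  · exact fun h => ⟨h.1.le, hv.trans_lt h.1, h.2⟩

lemma truncExp_univ {c B : ℝ} (hc : 0 ≤ c) (hB : 0 < B) : truncExpMeasure c B univ = 1 := by
  rw [truncExp_apply hc MeasurableSet.univ hB.le (mem_univ _)
    (EventuallyEq.of_eq (univ_inter _))]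
  simp

/-- The truncated exponential distribution as a value distribution. -/
def truncExp (c B : ℝ) (hc : 0 ≤ c) (hB : 0 < B) : Dist :=
  ⟨truncExpMeasure c B, ⟨truncExp_univ hc hB⟩, by
    have : IsProbabilityMeasure (truncExpMeasure c B) := ⟨truncExp_univ hc hB⟩
    rw [← compl_Ici, prob_compl_eq_zero_iff measurableSet_Ici, truncExp_Ici hc le_rfl hB.le]
    simp⟩

section

variable {c B : ℝ} {hc : 0 ≤ c} {hB : 0 < B}

lemma truncExp_law : (truncExp c B hc hB).law = truncExpMeasure c B := rfl

lemma surv_truncExp {v : ℝ} (hv : 0 ≤ v) (hvB : v ≤ B) :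
    surv (truncExp c B hc hB) v = Real.exp (-(c * v)) := by
  rw [surv, measureReal_def, truncExp_law, truncExp_Ici hc hv hvB,
    ENNReal.toReal_ofReal (Real.exp_pos _).le]

lemma cdf_truncExp {v : ℝ} (hv : 0 ≤ v) (hvB : v < B) :
    1 - (truncExp c B hc hB).cdf v = Real.exp (-(c * v)) := by
  rw [one_sub_cdf, measureReal_def, truncExp_law, truncExp_Ioi hc hv hvB,
    ENNReal.toReal_ofReal (Real.exp_pos _).le]

lemma truncExp_Ioi_self : truncExpMeasure c B (Ioi B) = 0 := by
  have h : Ioi B ∩ Ioo 0 B = ∅ := by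
    ext x
    simp only [mem_inter_iff, mem_Ioi, mem_Ioo, mem_empty_iff_false, iff_false]
    intro h
    linarith [h.1, h.2.2]
  rw [truncExpMeasure, Measure.add_apply, Measure.smul_apply,
    Measure.dirac_apply' _ measurableSet_Ioi, withDensity_apply _ measurableSet_Ioi,
    Measure.restrict_restrict measurableSet_Ioi, h]
  simp

lemma surv_truncExp_of_lt {v : ℝ} (hv : B < v) : surv (truncExp c B hc hB) v = 0 := by
  rw [surv, measureReal_def, truncExp_law,
    measure_mono_null (Ici_subset_Ioi.2 hv) truncExp_Ioi_self, ENNReal.toReal_zero]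

lemma isMHR_truncExp : IsMHR (truncExp c B hc hB) := by
  have hset : {v | (truncExp c B hc hB).cdf v < 1} = Iio B := by
    ext v
    simp only [mem_ofPred_eq, mem_Iio]
    constructor
    · intro h
      by_contra hv
      have h1 : 1 - (truncExp c B hc hB).cdf v = 0 := by
        rw [one_sub_cdf, measureReal_def, truncExp_law,
          measure_mono_null (Ioi_subset_Ioi (not_lt.1 hv)) truncExp_Ioi_self, ENNReal.toReal_zero]
      linarith
    · intro h
      refine cdf_lt_one_of_surv_pos h ?_
      rw [surv_truncExp hB.le le_rfl]
      exact Real.exp_pos _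
  have hcdf0 : ∀ v, v ≤ 0 → 0 ≤ 1 - (truncExp c B hc hB).cdf v := fun v _ => by
    rw [one_sub_cdf]; exact measureReal_nonneg
  refine ⟨(Ioi 0).indicator fun v => c * Real.exp (-(c * v)), fun v => ?_, ?_, ?_⟩
  · exact indicator_nonneg (fun v _ => mul_nonneg hc (Real.exp_pos _).le) v
  · rw [hset, truncExp_law, truncExpMeasure, Measure.restrict_add, Measure.restrict_smul,
      MeasureTheory.restrict_dirac' measurableSet_Iio, if_neg (by simp), smul_zero, zero_add,
      restrict_withDensity measurableSet_Iio, Measure.restrict_restrict measurableSet_Iio]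
    have : (fun v => ENNReal.ofReal ((Ioi (0 : ℝ)).indicator
        (fun v => c * Real.exp (-(c * v))) v)) =
        (Ioi (0 : ℝ)).indicator fun v => ENNReal.ofReal (c * Real.exp (-(c * v))) := by
      ext v
      by_cases hv : v ∈ Ioi (0 : ℝ) <;> simp [hv]
    rw [this, withDensity_indicator measurableSet_Ioi,
      Measure.restrict_restrict measurableSet_Ioi]
    congr 2
    ext x
    simp only [mem_inter_iff, mem_Iio, mem_Ioo, mem_Ioi]
    tauto
  · rw [hset]
    have hval : ∀ v, 0 < v → v < B → (Ioi (0 : ℝ)).indicator (fun v => c * Real.exp (-(c * v))) v /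
        (1 - (truncExp c B hc hB).cdf v) = c := by
      intro v h0 hvB
      rw [cdf_truncExp h0.le hvB, indicator_of_mem (mem_Ioi.2 h0),
        mul_div_cancel_right₀ _ (Real.exp_pos _).ne']
    have hval0 : ∀ v, v ≤ 0 → (Ioi (0 : ℝ)).indicator (fun v => c * Real.exp (-(c * v))) v /
        (1 - (truncExp c B hc hB).cdf v) = 0 := by
      intro v h0
      rw [indicator_of_notMem (by simpa using h0), zero_div]
    intro u hu w hw huw
    rcases le_or_gt u 0 with h | h
    · rcases le_or_gt w 0 with h' | h'
      · simp only [hval0 u h, hval0 w h', le_refl]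
      · simp only [hval0 u h, hval w h' hw, hc]
    · simp only [hval u h hu, hval w (h.trans_le huw) hw, le_refl]

lemma bddAbove_rev_truncExp : BddAbove (range (rev (truncExp c B hc hB))) := by
  refine ⟨B, ?_⟩
  rintro _ ⟨v, rfl⟩
  rcases le_or_gt v 0 with h | h
  · exact (mul_nonpos_of_nonpos_of_nonneg h (surv_nonneg _ _)).trans hB.le
  rcases le_or_gt v B with h' | h'
  · exact (mul_le_of_le_one_right h.le (surv_le_one _ _)).trans h'
  · rw [rev, surv_truncExp_of_lt h', mul_zero]
    exact hB.le

lemma le_OPT_truncExp : B * Real.exp (-(c * B)) ≤ OPT (truncExp c B hc hB) := by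
  have : rev (truncExp c B hc hB) B ≤ OPT (truncExp c B hc hB) := le_ciSup bddAbove_rev_truncExp B
  rwa [rev, surv_truncExp hB.le le_rfl] at this

end

/-! ### Admissible payment functions -/

/-- Nondecreasing payment functions whose expectation under every truncated exponential
distribution with rate `c ≤ 1 / B` is at least each price below `B` whose revenue falls short of
the share `Γ` of the optimal revenue `B exp (-c B)`. The value `∞` is allowed. -/
structure IsAdmissible (Γ : ℝ) (g : ℝ → ℝ≥0∞) : Prop where
  mono : Monotone g
  le_lintegral : ∀ c B L : ℝ, 0 ≤ c → 0 < B → c * B ≤ 1 → L < B →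
    L * Real.exp (-(c * L)) < Γ * (B * Real.exp (-(c * B))) →
    ENNReal.ofReal L ≤ ∫⁻ s, g s ∂truncExpMeasure c B

/-- Whether the share `Γ` of the optimal revenue can be guaranteed: every distribution with
monotone hazard rate has an admissible payment function whose expectation is at most some price
earning the share `Γ`. -/
def Feasible (Γ : ℝ) : Prop :=
  ∀ F : Dist, IsMHR F → 0 < OPT F → ∃ g : ℝ → ℝ≥0∞, IsAdmissible Γ g ∧
    ∃ v : ℝ, Γ * OPT F ≤ rev F v ∧ ∫⁻ s, g s ∂F.law ≤ ENNReal.ofReal v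

/-- The revenue curve of an exponential distribution of rate `c` increases up to `1 / c`. -/
lemma mul_exp_neg_lt {c x y : ℝ} (hx : 0 ≤ x) (hxy : x < y) (hc : c * y ≤ 1) :
    x * Real.exp (-(c * x)) < y * Real.exp (-(c * y)) := by
  have hy : 0 < y := hx.trans_lt hxy
  have h1 : x < y * Real.exp (-(c * (y - x))) := by
    rcases eq_or_ne (c * (y - x)) 0 with h0 | h0
    · rw [h0]; simpa using hxy
    · have h2 := Real.add_one_lt_exp (x := -(c * (y - x))) (by simpa using h0)
      nlinarith
  calc x * Real.exp (-(c * x)) < y * Real.exp (-(c * (y - x))) * Real.exp (-(c * x)) :=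
        mul_lt_mul_of_pos_right h1 (Real.exp_pos _)
    _ = _ := by rw [mul_assoc, ← Real.exp_add]; ring_nf

/-- A distribution with monotone hazard rate dominates the truncated exponential distribution with
the same probability of a sale at the truncation point. -/
lemma IsMHR.lintegral_truncExp_le {F : Dist} (hF : IsMHR F) {a r : ℝ} (ha : 0 ≤ a) (hr : 0 < r)
    (hS : surv F r = Real.exp (-(a * r))) {g : ℝ → ℝ≥0∞} (hg : Monotone g) :
    ∫⁻ s, g s ∂truncExpMeasure a r ≤ ∫⁻ s, g s ∂F.law := by
  have hd : Dominates F (truncExp a r ha hr) := by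
    refine dominates_of_surv_le fun v => ?_
    rcases le_total v 0 with h | h
    · rw [surv_of_nonpos _ h, surv_of_nonpos _ h]
    · rcases le_or_gt v r with h' | h'
      · rw [surv_truncExp h h']
        exact hF.exp_le_surv hr h' hS h
      · rw [surv_truncExp_of_lt h']
        exact surv_nonneg _ _
  exact hd.lintegral_le hg

/-- Near-optimal prices may be taken to sell with probability at least `1 / e`. -/
lemma IsMHR.exists_rev_ge {F : Dist} (hF : IsMHR F) {r₀ : ℝ} (h0 : 0 < rev F r₀) :
    ∃ r a : ℝ, 0 < r ∧ 0 ≤ a ∧ a * r ≤ 1 ∧ surv F r = Real.exp (-(a * r)) ∧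
      rev F r₀ ≤ rev F r := by
  have hr0 := pos_of_rev_pos h0
  have hS0 := surv_pos_of_rev_pos h0
  have haux : ∀ r, 0 < r → 0 < surv F r → ∃ a, 0 ≤ a ∧ surv F r = Real.exp (-(a * r)) := by
    intro r hr hS
    refine ⟨-Real.log (surv F r) / r, div_nonneg ?_ hr.le, ?_⟩
    · have := Real.log_nonpos hS.le (surv_le_one F r)
      linarith
    · rw [div_mul_cancel₀ _ hr.ne', neg_neg, Real.exp_log hS]
  obtain ⟨a, ha, hS⟩ := haux r₀ hr0 hS0
  rcases le_or_gt (a * r₀) 1 with h | h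
  · exact ⟨r₀, a, hr0, ha, h, hS, le_rfl⟩
  -- otherwise the price `1 / a` is at least as good
  have ha' : 0 < a := by
    rcases ha.eq_or_lt with rfl | h'
    · simp at h; linarith
    · exact h'
  have hlow := hF.exp_le_surv hr0 (v := 1 / a) (by rw [div_le_iff₀ ha']; linarith) hS
    (by positivity)
  rw [mul_one_div_cancel ha'.ne'] at hlow
  obtain ⟨b, hb, hSb⟩ := haux (1 / a) (by positivity) ((Real.exp_pos _).trans_le hlow)
  refine ⟨1 / a, b, by positivity, hb, ?_, hSb, ?_⟩
  · rw [hSb] at hlow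
    linarith [Real.exp_le_exp.1 hlow]
  · have h1 := Real.add_one_le_exp (a * r₀ - 1)
    calc rev F r₀ = 1 / a * (a * r₀ * Real.exp (-(a * r₀))) := by
          rw [rev, hS]; field_simp
      _ ≤ 1 / a * (Real.exp (a * r₀ - 1) * Real.exp (-(a * r₀))) := by
          gcongr
          linarith
      _ = 1 / a * Real.exp (-1) := by rw [← Real.exp_add]; ring_nf
      _ ≤ _ := mul_le_mul_of_nonneg_left hlow (by positivity)

/-- An admissible payment function whose expectation does not exceed some price earning the share
`Γ` yields such a price itself. -/
lemma IsAdmissible.le_rev {Γ : ℝ} (hΓ : 0 < Γ) (hΓ1 : Γ ≤ 1) {g : ℝ → ℝ≥0∞}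
    (hg : IsAdmissible Γ g) {F : Dist} (hF : IsMHR F) {p v : ℝ} (hp : 0 ≤ p)
    (hgp : ∫⁻ s, g s ∂F.law = ENNReal.ofReal p) (hpv : p ≤ v) (hv : Γ * OPT F ≤ rev F v) :
    Γ * OPT F ≤ rev F p := by
  by_contra hcon
  push Not at hcon
  have h1 : rev F p / Γ < OPT F := by rw [div_lt_iff₀ hΓ]; linarith
  obtain ⟨r₀, hr₀⟩ := exists_lt_rev h1
  have hrp0 : 0 ≤ rev F p := rev_nonneg F hp
  obtain ⟨r, a, hr, ha, har, hS, hrr⟩ := hF.exists_rev_ge ((div_nonneg hrp0 hΓ.le).trans_lt hr₀)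
  have h2 : rev F p < Γ * rev F r := by
    rw [div_lt_iff₀ hΓ] at hr₀
    nlinarith
  have hr' : 0 < rev F r := by
    by_contra h
    nlinarith
  rcases le_or_gt r p with h | h
  · have h3 := hF.min_le_rev (x := min (rev F r) (rev F v)) hr h hpv (min_le_left _ _)
      (min_le_right _ _)
    rcases min_le_iff.1 h3 with h4 | h4
    · nlinarith
    · linarith
  · -- `p` is too small for the truncated exponential distribution dominated by `F`
    have h3 : p * Real.exp (-(a * p)) < Γ * (r * Real.exp (-(a * r))) := by
      calc p * Real.exp (-(a * p)) ≤ rev F p :=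
            mul_le_mul_of_nonneg_left (hF.exp_le_surv hr h.le hS hp) hp
        _ < Γ * rev F r := h2
        _ = _ := by rw [rev, hS]
    have hcont : Continuous fun L : ℝ => L * Real.exp (-(a * L)) := by fun_prop
    have hev : ∀ᶠ L in 𝓝[>] p, L < r ∧ L * Real.exp (-(a * L)) < Γ * (r * Real.exp (-(a * r))) :=
      nhdsWithin_le_nhds ((eventually_lt_nhds h).and
        (hcont.continuousAt.eventually (eventually_lt_nhds h3)))
    obtain ⟨L, ⟨hLr, hL⟩, hpL⟩ := (hev.and self_mem_nhdsWithin).exists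
    have h4 := (hg.le_lintegral a r L ha hr har hLr hL).trans
      (hF.lintegral_truncExp_le ha hr hS hg.mono)
    rw [hgp, ENNReal.ofReal_le_ofReal_iff hp] at h4
    exact absurd hpL (not_lt.2 h4)

/-! ### Selection of convergent subsequences -/

/-- A sequence of functions with values in `[0, ∞]` has a subsequence converging on a given
countable set. -/
lemma exists_subseq_tendsto_on_countable (g : ℕ → ℝ → ℝ≥0∞) {D : Set ℝ} (hD : D.Countable) :
    ∃ φ : ℕ → ℕ, StrictMono φ ∧ ∀ x ∈ D, ∃ l, Tendsto (fun n => g (φ n) x) atTop (𝓝 l) := by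
  have : Countable D := hD.to_subtype
  obtain ⟨l, φ, hφ, hl⟩ := CompactSpace.tendsto_subseq fun n => fun x : D => g n x
  exact ⟨φ, hφ, fun x hx => ⟨l ⟨x, hx⟩, tendsto_pi_nhds.1 hl ⟨x, hx⟩⟩⟩

/-- **Helly's selection theorem** for monotone functions with values in `[0, ∞]`. -/
lemma exists_subseq_tendsto_of_monotone {g : ℕ → ℝ → ℝ≥0∞} (hg : ∀ n, Monotone (g n)) :
    ∃ (φ : ℕ → ℕ) (l : ℝ → ℝ≥0∞), StrictMono φ ∧ Monotone l ∧
      ∀ x, Tendsto (fun n => g (φ n) x) atTop (𝓝 (l x)) := by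
  obtain ⟨φ, hφ, h1⟩ := exists_subseq_tendsto_on_countable g
    (countable_range ((↑) : ℚ → ℝ))
  set f : ℝ → ℝ≥0∞ := fun x => liminf (fun n => g (φ n) x) atTop with hf
  set F : ℝ → ℝ≥0∞ := fun x => limsup (fun n => g (φ n) x) atTop with hFdef
  have hfm : Monotone f := fun x y hxy =>
    liminf_le_liminf (Eventually.of_forall fun n => hg _ hxy)
  have hFm : Monotone F := fun x y hxy =>
    limsup_le_limsup (Eventually.of_forall fun n => hg _ hxy)
  have hfF : ∀ x, f x ≤ F x := fun x => liminf_le_limsup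
  have hq : ∀ q : ℚ, F q = f q := by
    intro q
    obtain ⟨l, hl⟩ := h1 q ⟨q, rfl⟩
    simp only [hf, hFdef]
    rw [hl.limsup_eq, hl.liminf_eq]
  -- the lower and the upper limit agree wherever the lower one is continuous
  have hcont : ∀ x, ContinuousAt f x → F x = f x := by
    intro x hx
    refine le_antisymm ?_ (hfF x)
    refine ge_of_tendsto (hx.continuousWithinAt (s := Ioi x)) ?_
    filter_upwards [self_mem_nhdsWithin] with y hy
    obtain ⟨q, hq1, hq2⟩ := exists_rat_btwn (mem_Ioi.1 hy)
    calc F x ≤ F q := hFm hq1.le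
      _ = f q := hq q
      _ ≤ f y := hfm hq2.le
  obtain ⟨ψ, hψ, h2⟩ := exists_subseq_tendsto_on_countable (fun n => g (φ n))
    hfm.countable_not_continuousAt
  have hex : ∀ x, ∃ l, Tendsto (fun n => g (φ (ψ n)) x) atTop (𝓝 l) := by
    intro x
    by_cases hx : ContinuousAt f x
    · exact ⟨f x, (tendsto_of_liminf_eq_limsup rfl (hcont x hx)).comp hψ.tendsto_atTop⟩
    · exact h2 x hx
  choose l hl using hex
  exact ⟨φ ∘ ψ, l, hφ.comp hψ,
    fun x y hxy => le_of_tendsto_of_tendsto' (hl x) (hl y) fun n => hg _ hxy, hl⟩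

/-- Limits of admissible payment functions are admissible: on the bounded support of a truncated
exponential distribution no expectation is lost in the limit. -/
lemma IsAdmissible.of_tendsto {Γ : ℝ} {γ : ℕ → ℝ} (hγ : Tendsto γ atTop (𝓝 Γ))
    {g : ℕ → ℝ → ℝ≥0∞} (hg : ∀ n, IsAdmissible (γ n) (g n)) {l : ℝ → ℝ≥0∞}
    (hl : ∀ x, Tendsto (fun n => g n x) atTop (𝓝 (l x))) : IsAdmissible Γ l := by
  have hmono : Monotone l := fun x y hxy =>
    le_of_tendsto_of_tendsto' (hl x) (hl y) fun n => (hg n).mono hxy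
  refine ⟨hmono, fun c B L hc hB hcB hLB hL => ?_⟩
  have : IsProbabilityMeasure (truncExpMeasure c B) := ⟨truncExp_univ hc hB⟩
  have hle : ∀ᵐ s ∂truncExpMeasure c B, s ≤ B := by
    rw [ae_iff]
    simpa [Ioi_def] using truncExp_Ioi_self (c := c) (B := B)
  have hatom : ENNReal.ofReal (Real.exp (-(c * B))) * l B ≤ ∫⁻ s, l s ∂truncExpMeasure c B := by
    rw [lintegral_truncExp c B hmono.measurable]
    exact le_self_add
  rcases eq_or_ne (l B) ⊤ with htop | htop
  · rw [htop, ENNReal.mul_top (by simpa using Real.exp_pos _)] at hatom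
    exact le_top.trans hatom
  have hb : ∀ᶠ n in atTop, g n B ≤ l B + 1 :=
    ((hl B).eventually (gt_mem_nhds (ENNReal.lt_add_right htop one_ne_zero))).mono
      fun n hn => hn.le
  have hlim : Tendsto (fun n => ∫⁻ s, g n s ∂truncExpMeasure c B) atTop
      (𝓝 (∫⁻ s, l s ∂truncExpMeasure c B)) := by
    refine tendsto_lintegral_filter_of_dominated_convergence (fun _ => l B + 1)
      (Eventually.of_forall fun n => (hg n).mono.measurable) ?_ ?_
      (Eventually.of_forall fun s => hl s)
    · filter_upwards [hb] with n hn
      filter_upwards [hle] with s hs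
      exact ((hg n).mono hs).trans hn
    · simpa using htop
  refine ge_of_tendsto hlim ?_
  have hγ' : ∀ᶠ n in atTop, L * Real.exp (-(c * L)) < γ n * (B * Real.exp (-(c * B))) :=
    (hγ.mul_const _).eventually (lt_mem_nhds hL)
  filter_upwards [hγ'] with n hn
  exact (hg n).le_lintegral c B L hc hB hcB hLB hn

/-- The share that can be guaranteed is attained in the limit. -/
lemma Feasible.of_tendsto {Γ : ℝ} (hΓ : 0 < Γ) {γ : ℕ → ℝ} (hγ : Tendsto γ atTop (𝓝 Γ))
    (h : ∀ n, Feasible (γ n)) : Feasible Γ := by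
  intro F hF hO
  choose g hg v hv hgv using fun n => h n F hF hO
  obtain ⟨φ, l, hφ, -, hl⟩ := exists_subseq_tendsto_of_monotone fun n => (hg n).mono
  have hγφ : Tendsto (fun n => γ (φ n)) atTop (𝓝 Γ) := hγ.comp hφ.tendsto_atTop
  have hadm : IsAdmissible Γ l := IsAdmissible.of_tendsto hγφ (fun n => hg (φ n)) hl
  -- prices earning a positive share are bounded
  obtain ⟨C, hC⟩ := hF.eventually_rev_lt (ε := Γ / 2 * OPT F) (by positivity)
  obtain ⟨N, hN⟩ := eventually_atTop.1 (hγφ.eventually (lt_mem_nhds (half_lt_self hΓ)))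
  have hvb : ∀ n, v (φ (n + N)) ∈ Icc 0 C := by
    intro n
    have h1 : Γ / 2 * OPT F < rev F (v (φ (n + N))) :=
      (mul_lt_mul_of_pos_right (hN (n + N) (by omega)) hO).trans_le (hv _)
    constructor
    · exact (pos_of_rev_pos ((by positivity : 0 < Γ / 2 * OPT F).trans h1)).le
    · by_contra hlt
      exact absurd (hC _ (not_le.1 hlt).le) (not_lt.2 h1.le)
  obtain ⟨w, hw, ψ, hψ, hlim⟩ := isCompact_Icc.tendsto_subseq hvb
  have hsub : Tendsto (fun n => φ (ψ n + N)) atTop atTop :=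
    hφ.tendsto_atTop.comp ((tendsto_add_atTop_nat N).comp hψ.tendsto_atTop)
  refine ⟨l, hadm, w, ?_, ?_⟩
  · -- the revenue curve is upper semicontinuous
    have hΓlim : Tendsto (fun n => γ (φ (ψ n + N)) * OPT F) atTop (𝓝 (Γ * OPT F)) :=
      (hγ.comp hsub).mul_const _
    have key : ∀ ε > 0, Γ * OPT F ≤ w * (surv F w + ε) := by
      intro ε hε
      obtain ⟨w', hw', hS⟩ := exists_surv_lt_add F w hε
      refine le_of_tendsto_of_tendsto hΓlim (hlim.mul_const (surv F w + ε)) ?_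
      filter_upwards [hlim.eventually (lt_mem_nhds hw')] with n hn
      refine (hv _).trans (mul_le_mul_of_nonneg_left ?_ (hvb _).1)
      exact (surv_antitone F (le_of_lt hn)).trans hS.le
    have ht : Tendsto (fun ε : ℝ => w * (surv F w + ε)) (𝓝[>] 0) (𝓝 (w * (surv F w + 0))) := by
      have : Continuous fun ε : ℝ => w * (surv F w + ε) := by fun_prop
      exact this.continuousAt.continuousWithinAt
    rw [add_zero] at ht
    refine ge_of_tendsto ht ?_
    filter_upwards [self_mem_nhdsWithin] with ε hε
    exact key ε hε
  · have hfat : ∫⁻ s, l s ∂F.law ≤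
        liminf (fun n => ∫⁻ s, g (φ (ψ n + N)) s ∂F.law) atTop := by
      have : ∀ s, l s = liminf (fun n => g (φ (ψ n + N)) s) atTop := fun s =>
        (((hl s).comp ((tendsto_add_atTop_nat N).comp hψ.tendsto_atTop)).liminf_eq).symm
      rw [lintegral_congr this]
      exact lintegral_liminf_le fun n => (hg _).mono.measurable
    refine hfat.trans ?_
    have h2 : Tendsto (fun n => ENNReal.ofReal (v (φ (ψ n + N)))) atTop (𝓝 (ENNReal.ofReal w)) :=
      ENNReal.tendsto_ofReal hlim
    rw [← h2.liminf_eq]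
    exact liminf_le_liminf (Eventually.of_forall fun n => hgv _)

/-- The infimum of the expectations of admissible payment functions is attained. -/
lemma exists_admissible_minimizer {Γ : ℝ} (hne : ∃ g, IsAdmissible Γ g) (F : Dist) :
    ∃ g, IsAdmissible Γ g ∧
      ∫⁻ s, g s ∂F.law = ⨅ (k : ℝ → ℝ≥0∞) (_ : IsAdmissible Γ k), ∫⁻ s, k s ∂F.law := by
  set I := ⨅ (k : ℝ → ℝ≥0∞) (_ : IsAdmissible Γ k), ∫⁻ s, k s ∂F.law with hI
  have hle : ∀ k, IsAdmissible Γ k → I ≤ ∫⁻ s, k s ∂F.law := fun k hk => iInf₂_le k hk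
  rcases eq_or_ne I ⊤ with htop | htop
  · obtain ⟨g, hg⟩ := hne
    exact ⟨g, hg, le_antisymm (by rw [htop]; exact le_top) (hle g hg)⟩
  have hseq : ∀ n : ℕ, ∃ k, IsAdmissible Γ k ∧
      ∫⁻ s, k s ∂F.law < I + ((n : ℝ≥0∞) + 1)⁻¹ := by
    intro n
    have : I < I + ((n : ℝ≥0∞) + 1)⁻¹ := ENNReal.lt_add_right htop (by simp)
    conv_lhs at this => rw [hI]
    simpa only [iInf_lt_iff, exists_prop] using this
  choose k hk hkI using hseq
  obtain ⟨φ, l, hφ, -, hl⟩ := exists_subseq_tendsto_of_monotone fun n => (hk n).mono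
  have hadm : IsAdmissible Γ l :=
    IsAdmissible.of_tendsto tendsto_const_nhds (fun n => hk (φ n)) hl
  refine ⟨l, hadm, le_antisymm ?_ (hle l hadm)⟩
  have hfat : ∫⁻ s, l s ∂F.law ≤ liminf (fun n => ∫⁻ s, k (φ n) s ∂F.law) atTop := by
    have : ∀ s, l s = liminf (fun n => k (φ n) s) atTop := fun s => ((hl s).liminf_eq).symm
    rw [lintegral_congr this]
    exact lintegral_liminf_le fun n => (hk _).mono.measurable
  refine hfat.trans ?_
  have h0 : Tendsto (fun n : ℕ => ((n : ℝ≥0∞) + 1)⁻¹) atTop (𝓝 0) := by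
    have := (tendsto_add_atTop_iff_nat 1).2 ENNReal.tendsto_inv_nat_nhds_zero
    simpa using this
  have h1 : Tendsto (fun n => I + ((φ n : ℝ≥0∞) + 1)⁻¹) atTop (𝓝 (I + 0)) :=
    tendsto_const_nhds.add (h0.comp hφ.tendsto_atTop)
  rw [add_zero] at h1
  rw [← h1.liminf_eq]
  exact liminf_le_liminf (Eventually.of_forall fun n => (hkI _).le)

/-! ### From admissible payment functions to mechanisms -/

/-- The atom of a truncated exponential distribution alone enforces the admissibility bound if the
payment there is at least three times the value. -/
lemma le_lintegral_truncExp_of_three_mul_le {c B L : ℝ} (hB : 0 < B) (hcB : c * B ≤ 1)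
    (hL : L < B) {g : ℝ → ℝ≥0∞} (hg : Measurable g) (h3 : ENNReal.ofReal (3 * B) ≤ g B) :
    ENNReal.ofReal L ≤ ∫⁻ s, g s ∂truncExpMeasure c B := by
  rw [lintegral_truncExp c B hg]
  refine le_trans ?_ le_self_add
  refine le_trans ?_ (mul_le_mul_right h3 _)
  rw [← ENNReal.ofReal_mul (Real.exp_pos _).le]
  apply ENNReal.ofReal_le_ofReal
  have h1 : 1 / 3 ≤ Real.exp (-(c * B)) := by
    have h2 : Real.exp (-1) ≤ Real.exp (-(c * B)) := Real.exp_le_exp.2 (by linarith)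
    have h3 : Real.exp 1 < 3 := Real.exp_one_lt_three
    rw [Real.exp_neg] at h2
    have h4 : (3 : ℝ)⁻¹ < (Real.exp 1)⁻¹ := inv_strictAnti₀ (Real.exp_pos _) h3
    linarith
  nlinarith

/-- Some real-valued payment functions are admissible, whatever the share. -/
lemma isAdmissible_three_mul_max (Γ u : ℝ) :
    IsAdmissible Γ fun s => ENNReal.ofReal (3 * max s u) := by
  have hm : Monotone fun s : ℝ => ENNReal.ofReal (3 * max s u) := fun s t hst =>
    ENNReal.ofReal_le_ofReal (mul_le_mul_of_nonneg_left (max_le_max_right u hst) (by norm_num))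
  refine ⟨hm, fun c B L _ hB hcB hL _ => ?_⟩
  refine le_lintegral_truncExp_of_three_mul_le hB hcB hL hm.measurable ?_
  exact ENNReal.ofReal_le_ofReal (mul_le_mul_of_nonneg_left (le_max_left _ _) (by norm_num))

/-- An admissible payment function can be replaced by a real-valued one: its infinite values, which
are irrelevant for every distribution with a finite expected payment, are made finite without
losing admissibility. -/
lemma IsAdmissible.exists_real {Γ : ℝ} {g : ℝ → ℝ≥0∞} (hg : IsAdmissible Γ g) :
    ∃ h : ℝ → ℝ, Measurable h ∧ (∀ s, 0 ≤ h s) ∧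
      (∃ k, IsAdmissible Γ k ∧ ∀ s, k s ≤ ENNReal.ofReal (h s)) ∧
      ∀ F : Dist, ∫⁻ s, g s ∂F.law ≠ ⊤ → ∫⁻ s, ENNReal.ofReal (h s) ∂F.law = ∫⁻ s, g s ∂F.law := by
  have hgm := hg.mono.measurable
  by_cases hU : ∃ u, g u = ⊤
  · obtain ⟨u, hu⟩ := hU
    have hlt : ∀ s, g s ≠ ⊤ → s < u := fun s hs => by
      by_contra h
      exact hs (top_le_iff.1 (hu ▸ hg.mono (not_lt.1 h)))
    have hms : MeasurableSet {s | g s = ⊤} := hgm (measurableSet_singleton ⊤)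
    refine ⟨fun s => if g s = ⊤ then 3 * max (max s u) 0 else (g s).toReal,
      Measurable.ite hms (by fun_prop) hgm.ennreal_toReal, fun s => ?_,
      ⟨fun s => min (g s) (ENNReal.ofReal (3 * max s u)), ⟨?_, ?_⟩, ?_⟩, ?_⟩
    · dsimp only
      split_ifs
      · positivity
      · exact ENNReal.toReal_nonneg
    · exact fun s t hst => min_le_min (hg.mono hst) ((isAdmissible_three_mul_max Γ u).mono hst)
    · intro c B L hc hB hcB hLB hL
      have hkm : Monotone fun s => min (g s) (ENNReal.ofReal (3 * max s u)) := fun s t hst =>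
        min_le_min (hg.mono hst) ((isAdmissible_three_mul_max Γ u).mono hst)
      by_cases hb : g B ≤ ENNReal.ofReal (3 * u)
      · -- the payment function is unchanged on `[0, B]`
        refine (hg.le_lintegral c B L hc hB hcB hLB hL).trans_eq (lintegral_congr_ae ?_)
        have hle : ∀ᵐ s ∂truncExpMeasure c B, s ≤ B := by
          rw [ae_iff]
          simpa [Ioi_def] using truncExp_Ioi_self (c := c) (B := B)
        filter_upwards [hle] with s hs
        refine (min_eq_left ?_).symm
        refine (hg.mono hs).trans (hb.trans (ENNReal.ofReal_le_ofReal ?_))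
        exact mul_le_mul_of_nonneg_left (le_max_right _ _) (by norm_num)
      · refine le_lintegral_truncExp_of_three_mul_le hB hcB hLB hkm.measurable (le_min ?_ ?_)
        · by_cases hB' : g B = ⊤
          · rw [hB']; exact le_top
          · refine le_trans (ENNReal.ofReal_le_ofReal ?_) (not_le.1 hb).le
            linarith [hlt B hB']
        · exact ENNReal.ofReal_le_ofReal
            (mul_le_mul_of_nonneg_left (le_max_left _ _) (by norm_num))
    · intro s
      dsimp only
      split_ifs with h
      · refine (min_le_right _ _).trans (ENNReal.ofReal_le_ofReal ?_)
        exact mul_le_mul_of_nonneg_left (le_max_left _ _) (by norm_num)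
      · rw [ENNReal.ofReal_toReal h]
        exact min_le_left _ _
    · intro F hF
      refine lintegral_congr_ae ?_
      filter_upwards [ae_lt_top hgm hF] with s hs
      rw [if_neg hs.ne, ENNReal.ofReal_toReal hs.ne]
  · push Not at hU
    refine ⟨fun s => (g s).toReal, hgm.ennreal_toReal, fun s => ENNReal.toReal_nonneg,
      ⟨g, hg, fun s => (ENNReal.ofReal_toReal (hU s)).ge⟩, fun F _ => ?_⟩
    exact lintegral_congr fun s => ENNReal.ofReal_toReal (hU s)

/-- The smallest expected payment over all admissible payment functions: a concave functional of
the distribution that is monotone in stochastic dominance. -/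
def minPayment (Γ : ℝ) (F : Dist) : ℝ≥0∞ :=
  ⨅ (k : ℝ → ℝ≥0∞) (_ : IsAdmissible Γ k), ∫⁻ s, k s ∂F.law

lemma minPayment_mono (Γ : ℝ) {F₁ F₂ : Dist} (h : Dominates F₁ F₂) :
    minPayment Γ F₂ ≤ minPayment Γ F₁ :=
  iInf₂_mono fun _ hk => h.lintegral_le hk.mono

/-- The minimal expected payment is realized by a real-valued payment function whose expectation
under every other distribution is at least the minimal one there: this makes the pricing rule
proper. -/
lemma exists_payment (Γ : ℝ) (F : Dist) :
    ∃ h : ℝ → ℝ, Measurable h ∧ (∀ s, 0 ≤ h s) ∧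
      (∀ F' : Dist, minPayment Γ F' ≤ ∫⁻ s, ENNReal.ofReal (h s) ∂F'.law) ∧
      ∫⁻ s, ENNReal.ofReal (h s) ∂F.law = minPayment Γ F := by
  have hmax := isAdmissible_three_mul_max Γ 0
  by_cases htop : minPayment Γ F = ⊤
  · have hle : ∀ F' : Dist, minPayment Γ F' ≤ ∫⁻ s, ENNReal.ofReal (3 * max s 0) ∂F'.law :=
      fun F' => iInf₂_le _ hmax
    refine ⟨fun s => 3 * max s 0, by fun_prop, fun s => by positivity, hle, ?_⟩
    rw [htop]
    exact top_le_iff.1 (htop ▸ hle F)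
  · obtain ⟨g, hg, he⟩ := exists_admissible_minimizer ⟨_, hmax⟩ F
    obtain ⟨h, hm, h0, ⟨k, hk, hkh⟩, hint⟩ := hg.exists_real
    refine ⟨h, hm, h0, fun F' => (iInf₂_le k hk).trans (lintegral_mono hkh), ?_⟩
    exact (hint F (he ▸ htop)).trans he

/-- If the share `Γ` can be guaranteed, the minimal admissible payments form a monotone hidden
pricing mechanism that guarantees it. -/
lemma exists_mechanism_of_feasible {Γ : ℝ} (hΓ : 0 < Γ) (hΓ1 : Γ ≤ 1) (hf : Feasible Γ) :
    ∃ M, IsMonotoneHiddenPricing M ∧ (Γ : EReal) ≤ approxRatio M := by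
  choose h hm h0 hle heq using exists_payment Γ
  have hexp : ∀ F F' : Dist, expect F (fun s => h F' s) =
      ((∫⁻ s, ENNReal.ofReal (h F' s) ∂F.law : ℝ≥0∞) : EReal) := fun F F' =>
    expect_of_nonneg (Eventually.of_forall (h0 F'))
  have hpol : ∀ F, policy (fun s F' => h F' s) F = (minPayment Γ F : EReal) := by
    intro F
    rw [policy, hexp, heq]
  have hprop : IsProper fun s F' => h F' s := by
    refine ⟨hm, fun F F' => ?_, fun F F' => ?_⟩
    · have : ∀ s, ENNReal.ofReal (-h F' s) = 0 := fun s =>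
        ENNReal.ofReal_of_nonpos (neg_nonpos.2 (h0 F' s))
      simp [this]
    · rw [hexp, hexp, heq]
      exact EReal.coe_ennreal_le_coe_ennreal_iff.2 (hle F' F)
  refine ⟨hiddenPricing fun s F' => h F' s, ⟨_, hprop, fun F₁ F₂ hd => ?_, rfl⟩, ?_⟩
  · rw [hpol, hpol]
    exact EReal.coe_ennreal_le_coe_ennreal_iff.2 (minPayment_mono Γ hd)
  · refine le_iInf fun F => le_iInf fun hF => le_iInf fun hO => EReal.coe_le_coe_iff.2 ?_
    rw [le_div_iff₀ hO]
    obtain ⟨g, hg, v, hv, hgv⟩ := hf F hF hO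
    have hpv : minPayment Γ F ≤ ENNReal.ofReal v := (iInf₂_le g hg).trans hgv
    have hfin : minPayment Γ F ≠ ⊤ := ne_top_of_le_ne_top ENNReal.ofReal_ne_top hpv
    have hp : policy (fun s F' => h F' s) F = ((minPayment Γ F).toReal : EReal) := by
      rw [hpol, EReal.coe_ennreal_toReal hfin]
    rw [revenue_of_policy_eq_coe hprop hp]
    obtain ⟨k, hk, hke⟩ := exists_admissible_minimizer ⟨g, hg⟩ F
    have hv0 : 0 < v := pos_of_rev_pos ((mul_pos hΓ hO).trans_le hv)
    refine hk.le_rev hΓ hΓ1 hF ENNReal.toReal_nonneg (v := v) ?_ ?_ hv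
    · rw [ENNReal.ofReal_toReal hfin]
      exact hke
    · exact ENNReal.toReal_le_of_le_ofReal hv0.le hpv

/-! ### From mechanisms to admissible payment functions -/

/-- A mechanism with approximation ratio at least `Γ > 0` posts prices earning the share `Γ`. -/
lemma exists_price_of_le_approxRatio {Γ : ℝ} (hΓ : 0 < Γ) {h : PricingRule} (hh : IsProper h)
    (hr : (Γ : EReal) ≤ approxRatio (hiddenPricing h)) {F : Dist} (hF : IsMHR F)
    (hO : 0 < OPT F) : ∃ p : ℝ, policy h F = p ∧ Γ * OPT F ≤ rev F p := by
  have h1 : (Γ : EReal) ≤ (((hiddenPricing h).revenue F / OPT F : ℝ) : EReal) :=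
    hr.trans (iInf_le_of_le F (iInf_le_of_le hF (iInf_le _ hO)))
  rw [EReal.coe_le_coe_iff, le_div_iff₀ hO] at h1
  have hne : policy h F ≠ ⊤ := fun htop => by
    rw [revenue_of_policy_eq_top htop] at h1
    nlinarith
  have hp : policy h F = ((policy h F).toReal : EReal) :=
    (EReal.coe_toReal hne (policy_ne_bot hh F)).symm
  exact ⟨_, hp, by rwa [revenue_of_policy_eq_coe hh hp] at h1⟩

lemma OPT_truncExp_pos {c B : ℝ} {hc : 0 ≤ c} {hB : 0 < B} : 0 < OPT (truncExp c B hc hB) :=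
  (mul_pos hB (Real.exp_pos _)).trans_le le_OPT_truncExp

/-- Testing a proper pricing rule with point masses shows that its payments are positive. -/
lemma IsProper.pos_of_le_approxRatio {Γ : ℝ} (hΓ : 0 < Γ) {h : PricingRule} (hh : IsProper h)
    (hr : (Γ : EReal) ≤ approxRatio (hiddenPricing h)) (F : Dist) {t : ℝ} (ht : 0 < t) :
    0 < h t F := by
  obtain ⟨p, hp, hrev⟩ := exists_price_of_le_approxRatio hΓ hh hr
    (isMHR_truncExp (hc := le_rfl) (hB := ht)) OPT_truncExp_pos
  have hp0 : 0 < p := pos_of_rev_pos ((mul_pos hΓ OPT_truncExp_pos).trans_le hrev)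
  have h1 := hh.truthful (truncExp 0 t le_rfl ht) F
  have h2 : expect (truncExp 0 t le_rfl ht) (fun s => h s (truncExp 0 t le_rfl ht)) = p := hp
  rw [h2] at h1
  by_contra hcon
  have h3 : expect (truncExp 0 t le_rfl ht) (fun s => h s F) ≤ 0 := by
    rw [expect, truncExp_law, lintegral_truncExp 0 t (hh.measurable F).ennreal_ofReal,
      ENNReal.ofReal_of_nonpos (not_lt.1 hcon)]
    simpa using EReal.coe_ennreal_nonneg _
  have h4 : (p : EReal) ≤ 0 := h1.trans h3
  exact absurd hp0 (not_lt.2 (by exact_mod_cast h4))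

/-- The largest nondecreasing function below the payments at positive samples. -/
def lowerEnvelope (h : PricingRule) (F : Dist) (s : ℝ) : ℝ≥0∞ :=
  ⨅ (t : ℝ) (_ : s ≤ t ∧ 0 < t), ENNReal.ofReal (h t F)

lemma lowerEnvelope_mono (h : PricingRule) (F : Dist) : Monotone (lowerEnvelope h F) :=
  fun _ _ hst => le_iInf₂ fun t ht => iInf₂_le t ⟨hst.trans ht.1, ht.2⟩

lemma lowerEnvelope_le (h : PricingRule) (F : Dist) {s : ℝ} (hs : 0 < s) :
    lowerEnvelope h F s ≤ ENNReal.ofReal (h s F) := iInf₂_le s ⟨le_rfl, hs⟩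

lemma lowerEnvelope_ne_top (h : PricingRule) (F : Dist) (s : ℝ) : lowerEnvelope h F s ≠ ⊤ :=
  ne_top_of_le_ne_top ENNReal.ofReal_ne_top
    (iInf₂_le (max s 1) ⟨le_max_left _ _, lt_max_of_lt_right one_pos⟩)

lemma exists_near_lowerEnvelope (h : PricingRule) (F : Dist) (n : ℕ) (s : ℝ) :
    ∃ t, s ≤ t ∧ 0 < t ∧
      ENNReal.ofReal (h t F) ≤ lowerEnvelope h F s + ((n : ℝ≥0∞) + 1)⁻¹ := by
  have h1 : lowerEnvelope h F s < lowerEnvelope h F s + ((n : ℝ≥0∞) + 1)⁻¹ :=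
    ENNReal.lt_add_right (lowerEnvelope_ne_top h F s) (by simp)
  conv_lhs at h1 => rw [lowerEnvelope]
  simp only [iInf_lt_iff] at h1
  obtain ⟨t, ht, hlt⟩ := h1
  exact ⟨t, ht.1, ht.2, hlt.le⟩

/-- Rounding up to a multiple of `B / (n + 1)`. -/
def roundUp (B : ℝ) (n : ℕ) (s : ℝ) : ℝ := B * ⌈(n + 1) * s / B⌉ / (n + 1)

lemma le_roundUp {B : ℝ} (hB : 0 < B) (n : ℕ) (s : ℝ) : s ≤ roundUp B n s := by
  have h1 := Int.le_ceil ((n + 1) * s / B)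
  rw [div_le_iff₀ hB] at h1
  rw [roundUp, le_div_iff₀ (by positivity)]
  linarith

lemma roundUp_le_add {B : ℝ} (hB : 0 < B) (n : ℕ) (s : ℝ) : roundUp B n s ≤ s + B / (n + 1) := by
  have h1 := (Int.ceil_lt_add_one ((n + 1) * s / B)).le
  have hn : (0 : ℝ) < n + 1 := by positivity
  calc B * ⌈(n + 1) * s / B⌉ / (n + 1) ≤ B * ((n + 1) * s / B + 1) / (n + 1) := by gcongr
    _ = s + B / (n + 1) := by field_simp

lemma roundUp_le {B : ℝ} (hB : 0 < B) (n : ℕ) {s : ℝ} (hs : s ≤ B) : roundUp B n s ≤ B := by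
  have hn : (0 : ℝ) < n + 1 := by positivity
  have h1 : ⌈(n + 1) * s / B⌉ ≤ (n + 1 : ℤ) := by
    rw [Int.ceil_le, div_le_iff₀ hB]
    push_cast
    exact mul_le_mul_of_nonneg_left hs hn.le
  have h2 : (⌈(n + 1) * s / B⌉ : ℝ) ≤ n + 1 := by exact_mod_cast h1
  rw [roundUp, div_le_iff₀ hn]
  exact mul_le_mul_of_nonneg_left h2 hB.le

lemma tendsto_roundUp {B : ℝ} (hB : 0 < B) (s : ℝ) :
    Tendsto (fun n => roundUp B n s) atTop (𝓝 s) := by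
  have h0 : Tendsto (fun n : ℕ => s + B / ((n : ℝ) + 1)) atTop (𝓝 (s + 0)) := by
    have := (tendsto_one_div_add_atTop_nhds_zero_nat (𝕜 := ℝ)).const_mul B
    simp only [mul_zero, mul_one_div] at this
    exact tendsto_const_nhds.add this
  rw [add_zero] at h0
  exact tendsto_of_tendsto_of_tendsto_of_le_of_le tendsto_const_nhds h0
    (fun n => le_roundUp hB n s) (fun n => roundUp_le_add hB n s)

/-- Rounding up to finer and finer grids does not change, in the limit, the expectation of a
monotone function under a truncated exponential distribution. -/
lemma tendsto_lintegral_roundUp {c B : ℝ} (hc : 0 ≤ c) (hB : 0 < B) {g : ℝ → ℝ≥0∞}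
    (hg : Monotone g) (hgB : g B ≠ ⊤) :
    Tendsto (fun n => ∫⁻ s, g (roundUp B n s) ∂truncExpMeasure c B) atTop
      (𝓝 (∫⁻ s, g s ∂truncExpMeasure c B)) := by
  have : IsProbabilityMeasure (truncExpMeasure c B) := ⟨truncExp_univ hc hB⟩
  have hle : ∀ᵐ s ∂truncExpMeasure c B, s ≤ B := by
    rw [ae_iff]
    simpa [Ioi_def] using truncExp_Ioi_self (c := c) (B := B)
  have hct : ({s | ¬ContinuousAt g s} \ {B}).Countable :=
    hg.countable_not_continuousAt.mono sdiff_subset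
  have hae : ∀ᵐ s ∂truncExpMeasure c B, s ∉ {s | ¬ContinuousAt g s} \ {B} := by
    rw [← measure_eq_zero_iff_ae_notMem, truncExpMeasure, Measure.add_apply, Measure.smul_apply,
      Measure.dirac_apply' _ hct.measurableSet, indicator_of_notMem (by simp), smul_zero, zero_add]
    exact (withDensity_absolutelyContinuous _ _)
      (Measure.absolutelyContinuous_of_le Measure.restrict_le_self (hct.measure_zero volume))
  refine tendsto_lintegral_of_dominated_convergence' (fun _ => g B) (fun n => ?_) (fun n => ?_)
    (by simpa using hgB) ?_
  · refine Measurable.aemeasurable (hg.measurable.comp ?_)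
    unfold roundUp
    fun_prop
  · filter_upwards [hle] with s hs
    exact hg (roundUp_le hB n hs)
  · filter_upwards [hae] with s hs
    by_cases hsB : s = B
    · subst hsB
      have : ∀ n : ℕ, roundUp s n s = s := fun n =>
        le_antisymm (roundUp_le hB n le_rfl) (le_roundUp hB n s)
      simp only [this]
      exact tendsto_const_nhds
    · have hcont : ContinuousAt g s := by
        by_contra h
        exact hs ⟨h, hsB⟩
      exact hcont.tendsto.comp (tendsto_roundUp hB s)

/-- The price under a truncated exponential distribution is at most the expectation of the monotone
envelope of any payment function of the mechanism: moving the sample upwards to points where the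
payment is close to its envelope yields a dominating distribution, for which the truthful payment
is at least as large. -/
lemma policy_le_lintegral_lowerEnvelope {Γ : ℝ} (hΓ : 0 < Γ) {h : PricingRule} (hh : IsProper h)
    (hmon : IsMonotonePolicy (policy h)) (hr : (Γ : EReal) ≤ approxRatio (hiddenPricing h))
    (F : Dist) {c B : ℝ} (hc : 0 ≤ c) (hB : 0 < B) :
    policy h (truncExp c B hc hB) ≤
      ((∫⁻ s, lowerEnvelope h F s ∂truncExpMeasure c B : ℝ≥0∞) : EReal) := by
  set T := truncExp c B hc hB with hT
  set g := lowerEnvelope h F with hg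
  have hgm : Monotone g := lowerEnvelope_mono h F
  choose τ hτle hτpos hτ using exists_near_lowerEnvelope h F
  have key : ∀ n : ℕ, policy h T ≤
      ((∫⁻ s, g (roundUp B n s) ∂T.law + ((n : ℝ≥0∞) + 1)⁻¹ : ℝ≥0∞) : EReal) := by
    intro n
    set m : ℝ → ℝ := fun s => τ n (roundUp B n s) with hm
    have hmm : Measurable m := by
      have h1 : Measurable fun k : ℤ => τ n (B * (k : ℝ) / (n + 1)) := measurable_from_top
      exact h1.comp (Int.measurable_ceil.comp (by fun_prop : Measurable fun s : ℝ =>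
        ((n : ℝ) + 1) * s / B))
    have hrm : Measurable (roundUp B n) := by unfold roundUp; fun_prop
    let F' : Dist := ⟨T.law.map m, Measure.isProbabilityMeasure_map hmm.aemeasurable, by
      rw [Measure.map_apply hmm measurableSet_Iio]
      convert measure_empty (μ := T.law)
      ext s
      simp only [mem_preimage, mem_Iio, mem_empty_iff_false, iff_false, not_lt]
      exact (hτpos n _).le⟩
    have hlaw : F'.law = T.law.map m := rfl
    have hdom : Dominates F' T := by
      refine dominates_of_surv_le fun v => ?_
      rw [surv, surv, hlaw, map_measureReal_apply hmm measurableSet_Ici]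
      refine measureReal_mono fun s hs => ?_
      exact le_trans hs ((le_roundUp hB n s).trans (hτle n _))
    have hpos : ∀ᵐ s ∂F'.law, 0 ≤ h s F := by
      have : ∀ᵐ s ∂F'.law, 0 < s := by
        rw [hlaw, ae_map_iff hmm.aemeasurable measurableSet_Ioi]
        exact Eventually.of_forall fun s => hτpos n _
      filter_upwards [this] with s hs
      exact (hh.pos_of_le_approxRatio hΓ hr F hs).le
    refine (hmon F' T hdom).trans ((hh.truthful F' F).trans ?_)
    rw [expect_of_nonneg hpos, EReal.coe_ennreal_le_coe_ennreal_iff, hlaw,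
      lintegral_map (hh.measurable F).ennreal_ofReal hmm]
    calc ∫⁻ s, ENNReal.ofReal (h (m s) F) ∂T.law
        ≤ ∫⁻ s, (g (roundUp B n s) + ((n : ℝ≥0∞) + 1)⁻¹) ∂T.law :=
          lintegral_mono fun s => hτ n _
      _ = _ := by
          have hgr : Measurable fun s => g (roundUp B n s) := hgm.measurable.comp hrm
          rw [lintegral_add_left hgr]
          simp
  have hlim : Tendsto (fun n : ℕ => ∫⁻ s, g (roundUp B n s) ∂T.law + ((n : ℝ≥0∞) + 1)⁻¹) atTop
      (𝓝 (∫⁻ s, g s ∂truncExpMeasure c B + 0)) := by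
    refine (tendsto_lintegral_roundUp hc hB hgm (lowerEnvelope_ne_top h F B)).add ?_
    have := (tendsto_add_atTop_iff_nat 1).2 ENNReal.tendsto_inv_nat_nhds_zero
    simpa using this
  rw [add_zero] at hlim
  exact ge_of_tendsto' ((continuous_coe_ennreal_ereal.tendsto _).comp hlim) key

/-- The monotone envelopes of the payments of a mechanism are admissible, with the price posted by
the mechanism as a witness. -/
lemma feasible_of_le_approxRatio {Γ : ℝ} (hΓ : 0 < Γ) {M : Mechanism}
    (hM : IsMonotoneHiddenPricing M) (hr : (Γ : EReal) ≤ approxRatio M) : Feasible Γ := by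
  obtain ⟨h, hh, hmon, rfl⟩ := hM
  intro F hF hO
  refine ⟨lowerEnvelope h F, ⟨lowerEnvelope_mono h F, fun c B L hc hB hcB hLB hL => ?_⟩, ?_⟩
  · obtain ⟨p, hp, hrev⟩ := exists_price_of_le_approxRatio hΓ hh hr
      (isMHR_truncExp (hc := hc) (hB := hB)) OPT_truncExp_pos
    have h1 := policy_le_lintegral_lowerEnvelope hΓ hh hmon hr F hc hB
    rw [hp] at h1
    have hp0 : 0 < p := pos_of_rev_pos ((mul_pos hΓ OPT_truncExp_pos).trans_le hrev)
    have hLp : L ≤ p := by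
      by_contra hcon
      push Not at hcon
      have h2 := mul_exp_neg_lt (c := c) hp0.le hcon (by nlinarith)
      rw [rev, surv_truncExp hp0.le (hcon.trans hLB).le] at hrev
      have h3 : Γ * (B * Real.exp (-(c * B))) ≤ Γ * OPT (truncExp c B hc hB) :=
        mul_le_mul_of_nonneg_left le_OPT_truncExp hΓ.le
      linarith
    refine (ENNReal.ofReal_le_ofReal hLp).trans ?_
    rw [← EReal.coe_ennreal_le_coe_ennreal_iff, EReal.coe_ennreal_ofReal, max_eq_left hp0.le]
    exact h1
  · obtain ⟨p, hp, hrev⟩ := exists_price_of_le_approxRatio hΓ hh hr hF hO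
    have hp0 : 0 < p := pos_of_rev_pos ((mul_pos hΓ hO).trans_le hrev)
    refine ⟨p, hrev, ?_⟩
    have hpos := hF.ae_pos hO
    have h1 : policy h F = ((∫⁻ s, ENNReal.ofReal (h s F) ∂F.law : ℝ≥0∞) : EReal) := by
      refine expect_of_nonneg ?_
      filter_upwards [hpos] with s hs
      exact (hh.pos_of_le_approxRatio hΓ hr F hs).le
    calc ∫⁻ s, lowerEnvelope h F s ∂F.law ≤ ∫⁻ s, ENNReal.ofReal (h s F) ∂F.law := by
          refine lintegral_mono_ae ?_
          filter_upwards [hpos] with s hs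
          exact lowerEnvelope_le h F hs
      _ = ENNReal.ofReal p := by
          rw [← EReal.coe_ennreal_eq_coe_ennreal_iff, ← h1, hp, EReal.coe_ennreal_ofReal,
            max_eq_left hp0.le]

/-! ### Elementary bounds for the exponential function -/

lemma nonneg_of_hasDerivAt_nonneg {f f' : ℝ → ℝ} (hf : ∀ x, HasDerivAt f (f' x) x)
    (h0 : f 0 = 0) (h' : ∀ x, 0 ≤ x → 0 ≤ f' x) {x : ℝ} (hx : 0 ≤ x) : 0 ≤ f x := by
  have hm : MonotoneOn f (Ici 0) := by
    refine monotoneOn_of_deriv_nonneg (convex_Ici 0)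
      (fun y _ => (hf y).continuousAt.continuousWithinAt)
      (fun y _ => (hf y).differentiableAt.differentiableWithinAt) fun y hy => ?_
    rw [(hf y).deriv]
    rw [interior_Ici] at hy
    exact h' y (le_of_lt hy)
  have := hm (mem_Ici.2 le_rfl) (mem_Ici.2 hx) hx
  rwa [h0] at this

lemma hasDerivAt_exp_neg (x : ℝ) : HasDerivAt (fun x => Real.exp (-x)) (-Real.exp (-x)) x := by
  have := (hasDerivAt_neg x).exp
  simpa using this

lemma exp_neg_ge_one {x : ℝ} : 1 - x ≤ Real.exp (-x) := by
  have := Real.add_one_le_exp (-x)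
  linarith

lemma exp_neg_le_two {x : ℝ} (hx : 0 ≤ x) : Real.exp (-x) ≤ 1 - x + x ^ 2 / 2 := by
  have := nonneg_of_hasDerivAt_nonneg (f := fun x => 1 - x + x ^ 2 / 2 - Real.exp (-x))
    (f' := fun x => Real.exp (-x) - (1 - x)) (fun y => by
      refine ((((hasDerivAt_id y).const_sub 1).add
        (((hasDerivAt_id y).pow 2).div_const 2)).sub (hasDerivAt_exp_neg y)).congr_deriv ?_
      simp only [id]
      ring) (by simp) (fun y _ => by linarith [exp_neg_ge_one (x := y)]) hx
  linarith

lemma exp_neg_ge_three {x : ℝ} (hx : 0 ≤ x) :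
    1 - x + x ^ 2 / 2 - x ^ 3 / 6 ≤ Real.exp (-x) := by
  have := nonneg_of_hasDerivAt_nonneg
    (f := fun x => Real.exp (-x) - (1 - x + x ^ 2 / 2 - x ^ 3 / 6))
    (f' := fun x => 1 - x + x ^ 2 / 2 - Real.exp (-x)) (fun y => by
      refine ((hasDerivAt_exp_neg y).sub ((((hasDerivAt_id y).const_sub 1).add
        (((hasDerivAt_id y).pow 2).div_const 2)).sub
        (((hasDerivAt_id y).pow 3).div_const 6))).congr_deriv ?_
      simp only [id]
      ring) (by simp) (fun y hy => by linarith [exp_neg_le_two hy]) hx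
  linarith

lemma exp_neg_le_four {x : ℝ} (hx : 0 ≤ x) :
    Real.exp (-x) ≤ 1 - x + x ^ 2 / 2 - x ^ 3 / 6 + x ^ 4 / 24 := by
  have := nonneg_of_hasDerivAt_nonneg
    (f := fun x => 1 - x + x ^ 2 / 2 - x ^ 3 / 6 + x ^ 4 / 24 - Real.exp (-x))
    (f' := fun x => Real.exp (-x) - (1 - x + x ^ 2 / 2 - x ^ 3 / 6)) (fun y => by
      refine ((((((hasDerivAt_id y).const_sub 1).add
        (((hasDerivAt_id y).pow 2).div_const 2)).sub
        (((hasDerivAt_id y).pow 3).div_const 6)).add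
        (((hasDerivAt_id y).pow 4).div_const 24)).sub (hasDerivAt_exp_neg y)).congr_deriv ?_
      simp only [id]
      ring) (by simp) (fun y hy => by linarith [exp_neg_ge_three hy]) hx
  linarith

lemma exp_neg_ge_five {x : ℝ} (hx : 0 ≤ x) :
    1 - x + x ^ 2 / 2 - x ^ 3 / 6 + x ^ 4 / 24 - x ^ 5 / 120 ≤ Real.exp (-x) := by
  have := nonneg_of_hasDerivAt_nonneg
    (f := fun x => Real.exp (-x) -
      (1 - x + x ^ 2 / 2 - x ^ 3 / 6 + x ^ 4 / 24 - x ^ 5 / 120))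
    (f' := fun x => 1 - x + x ^ 2 / 2 - x ^ 3 / 6 + x ^ 4 / 24 - Real.exp (-x)) (fun y => by
      refine ((hasDerivAt_exp_neg y).sub (((((((hasDerivAt_id y).const_sub 1).add
        (((hasDerivAt_id y).pow 2).div_const 2)).sub
        (((hasDerivAt_id y).pow 3).div_const 6)).add
        (((hasDerivAt_id y).pow 4).div_const 24)).sub
        (((hasDerivAt_id y).pow 5).div_const 120)))).congr_deriv ?_
      simp only [id]
      ring) (by simp) (fun y hy => by linarith [exp_neg_le_four hy]) hx
  linarith

/-! ### An admissible payment function for the share `0.79` -/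

/-- A price below the truncation point that falls short of the share `G` lies below every price `w`
that earns it. -/
lemma le_of_mul_exp_neg {l w a G : ℝ} (hw : 0 ≤ w) (ha : a ≤ 1) (hla : l < a)
    (h : G * (a * Real.exp (-a)) ≤ w * Real.exp (-w))
    (hl : l * Real.exp (-l) < G * (a * Real.exp (-a))) : l ≤ w := by
  by_contra hcon
  push Not at hcon
  have := mul_exp_neg_lt (c := 1) hw hcon (by linarith)
  simp only [one_mul] at this
  linarith

/-- Comparing the revenues at the prices `w ≤ a` through a quadratic bound for `exp (w - a)`. -/
lemma mul_exp_neg_le_of_quadratic {w a G : ℝ} (hwa : w ≤ a) (ha : 0 ≤ G * a)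
    (h : G * a * (1 - (a - w) + (a - w) ^ 2 / 2) ≤ w) :
    G * (a * Real.exp (-a)) ≤ w * Real.exp (-w) := by
  have h1 := exp_neg_le_two (x := a - w) (by linarith)
  calc G * (a * Real.exp (-a)) = G * a * Real.exp (-(a - w)) * Real.exp (-w) := by
        rw [mul_assoc (G * a), ← Real.exp_add]; ring_nf
    _ ≤ w * Real.exp (-w) := by
        refine mul_le_mul_of_nonneg_right ?_ (Real.exp_pos _).le
        exact (mul_le_mul_of_nonneg_left h1 ha).trans h

/-- The price `w` earns the share `0.79`; its constants are those of the lower bound for the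
expected payment in `le_hinge_payment`. -/
lemma price_poly_pos {a : ℝ} (h0 : 0.14 ≤ a) (h1 : a ≤ 1) {w : ℝ}
    (hw : w = 0.8659 - 0.8725 * (1 - a + a ^ 2 / 2 - a ^ 3 / 6 + a ^ 4 / 24)) :
    0.79 * a * (1 - (a - w) + (a - w) ^ 2 / 2) ≤ w := by
  -- the Bernstein coefficients of the difference are positive on both subintervals
  subst hw
  rcases le_total a 0.5 with h | h
  · have hl : 0 ≤ a - 0.14 := by linarith
    have hu : 0 ≤ 0.5 - a := by linarith
    have hb : ∀ k : ℕ, 0 ≤ (a - 0.14) ^ k * (0.5 - a) ^ (9 - k) := fun k => by positivity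
    have b0 := hb 0
    have b1 := hb 1
    have b2 := hb 2
    have b3 := hb 3
    have b4 := hb 4
    have b5 := hb 5
    have b6 := hb 6
    have b7 := hb 7
    have b8 := hb 8
    have b9 := hb 9
    norm_num only at b0 b1 b2 b3 b4 b5 b6 b7 b8 b9
    linarith
  · have hl : 0 ≤ a - 0.5 := by linarith
    have hu : 0 ≤ 1 - a := by linarith
    have hb : ∀ k : ℕ, 0 ≤ (a - 0.5) ^ k * (1 - a) ^ (9 - k) := fun k => by positivity
    have b0 := hb 0
    have b1 := hb 1
    have b2 := hb 2
    have b3 := hb 3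
    have b4 := hb 4
    have b5 := hb 5
    have b6 := hb 6
    have b7 := hb 7
    have b8 := hb 8
    have b9 := hb 9
    norm_num only at b0 b1 b2 b3 b4 b5 b6 b7 b8 b9
    linarith

/-- The one-variable inequality behind the admissibility of the payment function below, in units in
which the rate is `1`: `a` is the truncation point, `x` the first kink. -/
lemma le_hinge_payment {a x l : ℝ} (ha0 : 0 < a) (ha1 : a ≤ 1) (hx : 0 ≤ x) (hla : l < a)
    (hl : l * Real.exp (-l) < 0.79 * (a * Real.exp (-a))) :
    l ≤ 0.79 * x + 0.79 * max (Real.exp (-x) - Real.exp (-a)) 0 +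
      0.0825 * max (Real.exp (-(1.29 * x)) - Real.exp (-a)) 0 := by
  have m1 := le_max_left (Real.exp (-x) - Real.exp (-a)) 0
  have m2 := le_max_left (Real.exp (-(1.29 * x)) - Real.exp (-a)) 0
  have n1 := le_max_right (Real.exp (-x) - Real.exp (-a)) 0
  have n2 := le_max_right (Real.exp (-(1.29 * x)) - Real.exp (-a)) 0
  rcases le_or_gt a x with hax | hxa
  · have h1 : l ≤ 0.79 * a := by
      refine le_of_mul_exp_neg (by positivity) ha1 hla ?_ hl
      rw [← mul_assoc]
      exact mul_le_mul_of_nonneg_left (Real.exp_le_exp.2 (by linarith)) (by positivity)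
    linarith
  have e3 := exp_neg_ge_three hx
  rcases le_total a 0.14 with has | hal
  -- for small `a` the kinks lie in the quadratic range of the exponential function
  · have h1 : l ≤ 0.79 * (a - 0.2 * a ^ 2 - 0.08 * a ^ 3) := by
      refine le_of_mul_exp_neg (a := a) ?_ ha1 hla (mul_exp_neg_le_of_quadratic ?_ ?_ ?_) hl
      · have : 0 ≤ a * (1 - 0.2 * a - 0.08 * a ^ 2) := mul_nonneg ha0.le (by nlinarith)
        linarith
      · nlinarith [pow_pos ha0 2, pow_pos ha0 3]
      · positivity
      · set u := a - 0.79 * (a - 0.2 * a ^ 2 - 0.08 * a ^ 3) with hu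
        have ha2 : 0 < a ^ 2 := by positivity
        have ha3 : 0 < a ^ 3 := by positivity
        have h2 : a ^ 2 ≤ 0.14 * a := by nlinarith
        have h3 : a ^ 3 ≤ 0.14 * a ^ 2 := by nlinarith
        have hu0 : 0 ≤ u := by rw [hu]; linarith
        have hu1 : u ≤ 0.25 * a := by rw [hu]; linarith
        have hu2 : u ^ 2 ≤ (0.25 * a) ^ 2 := pow_le_pow_left₀ hu0 hu1 2
        have h4 : 1 - u + u ^ 2 / 2 ≤ 1 - 0.2 * a - 0.08 * a ^ 2 := by
          linarith [hu]
        calc 0.79 * a * (1 - u + u ^ 2 / 2) ≤ 0.79 * a * (1 - 0.2 * a - 0.08 * a ^ 2) :=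
              mul_le_mul_of_nonneg_left h4 (by positivity)
          _ = _ := by ring
    have e2 := exp_neg_le_two ha0.le
    obtain ⟨t, rfl⟩ : ∃ t, a = 1.29 * t := ⟨a / 1.29, by field_simp⟩
    have ht : 0 < t := by linarith
    -- the bound for `l` at the point `x = t`
    have ht3 : 0.79 * (1.29 * t - 0.2 * (1.29 * t) ^ 2 - 0.08 * (1.29 * t) ^ 3) ≤
        0.79 * (1.29 * t - (1.29 * t) ^ 2 / 2 + t ^ 2 / 2 - t ^ 3 / 6) := by
      have h2 : 0 < t ^ 2 := by positivity
      have h3 : 0 < t ^ 3 := by positivity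
      linarith
    rcases le_total x t with h | h
    · have h4 : 1.29 * (t - x) * (1 - 1.29 * t) ≤
          Real.exp (-(1.29 * x)) - Real.exp (-(1.29 * t)) := by
        have h5 := Real.add_one_le_exp (1.29 * (t - x))
        have h6 : Real.exp (-(1.29 * x)) = Real.exp (-(1.29 * t)) * Real.exp (1.29 * (t - x)) := by
          rw [← Real.exp_add]; ring_nf
        have h7 := exp_neg_ge_one (x := 1.29 * t)
        have h8 := mul_le_mul_of_nonneg_left h5 (Real.exp_pos (-(1.29 * t))).le
        have h9 : 0 ≤ 1.29 * (t - x) * (Real.exp (-(1.29 * t)) - (1 - 1.29 * t)) :=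
          mul_nonneg (by linarith) (by linarith)
        rw [h6]
        linarith
      have h9 : 0 ≤ (t - x) * (0.0825 * 1.29 * (1 - 1.29 * t) - 0.79 * t) :=
        mul_nonneg (by linarith) (by linarith)
      have h10 : 0 ≤ (t - x) * (t - x) := mul_self_nonneg _
      have h11 : x ^ 3 ≤ t ^ 3 := pow_le_pow_left₀ hx h 3
      linarith
    · have h12 : 0 ≤ (x - t) * ((x + t) / 2 - (x ^ 2 + x * t + t ^ 2) / 6) := by
        refine mul_nonneg (by linarith) ?_
        nlinarith
      linarith
  · have e4 := exp_neg_le_four ha0.le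
    -- minimizing the expected payment over `x` leaves this lower bound, which earns the share
    set w : ℝ := 0.8659 - 0.8725 * (1 - a + a ^ 2 / 2 - a ^ 3 / 6 + a ^ 4 / 24) with hw
    have hw0 : 0 ≤ w := by
      have : 0 ≤ 1 - (a - w) + (a - w) ^ 2 / 2 := by nlinarith [sq_nonneg (a - w - 1)]
      exact (by positivity : 0 ≤ 0.79 * a * (1 - (a - w) + (a - w) ^ 2 / 2)).trans
        (price_poly_pos hal ha1 hw)
    have h1 : l ≤ w := by
      refine le_of_mul_exp_neg hw0 ha1 hla (mul_exp_neg_le_of_quadratic ?_ ?_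
        (price_poly_pos hal ha1 hw)) hl
      · rw [hw]
        nlinarith [pow_pos ha0 2, pow_pos ha0 3, pow_pos ha0 4]
      · positivity
    have e5 := exp_neg_ge_three (x := 1.29 * x) (by positivity)
    -- the minimum over `x` is attained near `0.1226`
    have h2 : 0.8659 ≤ 0.79 * x + 0.79 * (1 - x + x ^ 2 / 2 - x ^ 3 / 6) +
        0.0825 * (1 - 1.29 * x + (1.29 * x) ^ 2 / 2 - (1.29 * x) ^ 3 / 6) := by
      have hx1 : 0 ≤ 1 - x := by linarith
      nlinarith [sq_nonneg (x - 0.1226), mul_nonneg hx1 (sq_nonneg (x - 0.1226)),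
        mul_nonneg hx (sq_nonneg (x - 0.1226))]
    linarith

/-- Since `y exp (-y)` decreases on `[1, ∞)`, a value larger than the one at `y` is attained only to
the left of `y`. -/
lemma lt_of_mul_exp_neg_lt {x y : ℝ} (hy : 1 ≤ y)
    (h : y * Real.exp (-y) < x * Real.exp (-x)) : x < y := by
  by_contra hcon
  push Not at hcon
  have h1 := Real.add_one_le_exp (x - y)
  have h2 : x ≤ y * Real.exp (x - y) := by nlinarith
  have h3 : x * Real.exp (-x) ≤ y * Real.exp (-y) := by
    calc x * Real.exp (-x) ≤ y * Real.exp (x - y) * Real.exp (-x) :=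
          mul_le_mul_of_nonneg_right h2 (Real.exp_pos _).le
      _ = _ := by rw [mul_assoc, ← Real.exp_add]; ring_nf
  linarith

/-- The one-variable inequality behind the bound for the expected payment under the shifted
exponential distribution with rate `1` starting at `m`: the expected payment stays strictly below
every price `y` beyond the optimal one that earns less than the share `0.79` of the optimal
revenue. -/
lemma hinge_price_le {m y : ℝ} (hm : 0 ≤ m) (hy : 1 ≤ y) (hmy : m ≤ y)
    (h1 : m ≤ 1 → y * Real.exp (-(y - m)) < 0.79 * Real.exp (m - 1))
    (h2 : 1 ≤ m → y * Real.exp (-(y - m)) < 0.79 * m) :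
    1.0005 * (0.79 * (m + 0.077) + 0.79 * Real.exp (-0.077) +
      0.0825 * Real.exp (-(1.29 * 0.077 + 0.29 * m))) ≤ y := by
  have e1 : Real.exp (-0.077) ≤ 0.926 := by
    have := exp_neg_le_four (x := 0.077) (by norm_num)
    norm_num at this ⊢
    linarith
  -- it suffices to compare with a price `P` whose revenue is at least `0.79 * m`
  have key : ∀ P : ℝ, 1 ≤ m → 0.79 * m ≤ P * Real.exp (-(P - m)) → P ≤ y := by
    intro P hm1 hP
    by_contra hcon
    push Not at hcon
    have h3 := h2 hm1
    have e : ∀ z : ℝ, z * Real.exp (-(z - m)) = z * Real.exp (-z) * Real.exp m := by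
      intro z
      rw [mul_assoc, ← Real.exp_add]
      ring_nf
    rw [e] at h3 hP
    have h4 := lt_of_mul_lt_mul_right (h3.trans_le hP) (Real.exp_pos m).le
    exact lt_asymm hcon (lt_of_mul_exp_neg_lt hy h4)
  rcases le_total m 1 with hm1 | hm1
  · have h3 := h1 hm1
    have e2 : Real.exp (-(1.29 * 0.077 + 0.29 * m)) ≤ 1 := by
      rw [Real.exp_le_one_iff]
      linarith
    have h4 : 1.67 < y := by
      refine lt_of_mul_exp_neg_lt hy ?_
      have e3 := exp_neg_ge_three (x := 0.67) (by norm_num)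
      have e4 : y * Real.exp (-y) * Real.exp m < 0.79 * Real.exp (-1) * Real.exp m := by
        rw [mul_assoc, mul_assoc, ← Real.exp_add, ← Real.exp_add]
        convert h3 using 3 <;> ring_nf
      have e5 := lt_of_mul_lt_mul_right e4 (Real.exp_pos m).le
      have e6 : Real.exp (-1.67) = Real.exp (-0.67) * Real.exp (-1) := by
        rw [← Real.exp_add]; norm_num
      rw [e6]
      have e7 : 0.79 ≤ 1.67 * Real.exp (-0.67) := by
        norm_num at e3 ⊢
        linarith
      have e8 := mul_le_mul_of_nonneg_right e7 (Real.exp_pos (-1)).le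
      linarith
    linarith
  rcases le_total m 2.8 with hm2 | hm2
  · -- a linear bound for the expected payment and a tangent to the exponential function at `0.47`
    have e2 : Real.exp (-(1.29 * 0.077 + 0.29 * m)) ≤ 0.6776 * (1 - 0.739 * (0.29 * (m - 1))) := by
      have f1 := exp_neg_le_four (x := 0.38933) (by norm_num)
      have f2 := exp_neg_le_two (x := 0.29 * (m - 1)) (by linarith)
      have f3 : Real.exp (-(1.29 * 0.077 + 0.29 * m)) =
          Real.exp (-0.38933) * Real.exp (-(0.29 * (m - 1))) := by
        rw [← Real.exp_add]; ring_nf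
      rw [f3]
      refine mul_le_mul (by norm_num at f1 ⊢; linarith) ?_ (Real.exp_pos _).le (by norm_num)
      nlinarith
    refine le_trans ?_ (key (0.7785 * m + 0.8607) hm1 ?_)
    · linarith
    · have f1 := exp_neg_ge_five (x := 0.47) (by norm_num)
      have f2 := Real.add_one_le_exp (0.47 - (0.7785 * m + 0.8607 - m))
      have f3 : Real.exp (-(0.7785 * m + 0.8607 - m)) =
          Real.exp (-0.47) * Real.exp (0.47 - (0.7785 * m + 0.8607 - m)) := by
        rw [← Real.exp_add]; ring_nf
      have f4 : 0.6249 * (0.47 - (0.7785 * m + 0.8607 - m) + 1) ≤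
          Real.exp (-(0.7785 * m + 0.8607 - m)) := by
        rw [f3]
        refine mul_le_mul (by norm_num at f1 ⊢; linarith) f2 (by linarith) (Real.exp_pos _).le
      refine le_trans ?_ (mul_le_mul_of_nonneg_left f4 (by linarith))
      nlinarith [sq_nonneg (m - 1.7375)]
  · have e2 : Real.exp (-(1.29 * 0.077 + 0.29 * m)) ≤ 0.411 := by
      have f1 := exp_neg_le_four (x := 0.9) (by norm_num)
      have f2 : Real.exp (-(1.29 * 0.077 + 0.29 * m)) ≤ Real.exp (-0.9) :=
        Real.exp_le_exp.2 (by linarith)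
      refine f2.trans ?_
      norm_num at f1 ⊢
      linarith
    rcases le_total 3.95 m with hm3 | hm3
    · linarith
    · refine le_trans ?_ (key (0.7904 * m + 0.8268) hm1 ?_)
      · linarith
      · have f2 := exp_neg_ge_one (x := 0.7904 * m + 0.8268 - m)
        refine le_trans ?_ (mul_le_mul_of_nonneg_left f2 (by linarith))
        nlinarith

/-- The layer-cake formula for the expected excess over `k`. -/
lemma lintegral_excess (F : Dist) (k : ℝ) :
    ∫⁻ s, ENNReal.ofReal (s - k) ∂F.law = ∫⁻ v in Ioi k, ENNReal.ofReal (surv F v) := by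
  have h1 : ∫⁻ s, ENNReal.ofReal (s - k) ∂F.law = ∫⁻ s, ENNReal.ofReal (max (s - k) 0) ∂F.law := by
    refine lintegral_congr fun s => ?_
    rcases le_total (s - k) 0 with h | h
    · rw [max_eq_right h, ENNReal.ofReal_of_nonpos h, ENNReal.ofReal_zero]
    · rw [max_eq_left h]
  rw [h1, lintegral_eq_lintegral_meas_le F.law (f := fun s => max (s - k) 0)
    (Eventually.of_forall fun s => le_max_right _ _) (by fun_prop)]
  have h2 : ∀ t ∈ Ioi (0 : ℝ), F.law {s | t ≤ max (s - k) 0} = ENNReal.ofReal (surv F (k + t)) := by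
    intro t ht
    rw [← measure_Ici]
    congr 1
    ext s
    simp only [mem_ofPred_eq, mem_Ici, le_max_iff]
    constructor
    · rintro (h | h)
      · linarith
      · exact absurd h (not_le.2 ht)
    · exact fun h => Or.inl (by linarith)
  rw [setLIntegral_congr_fun measurableSet_Ioi h2, ← lintegral_indicator measurableSet_Ioi,
    ← lintegral_indicator measurableSet_Ioi,
    ← lintegral_add_left_eq_self (fun v => (Ioi k).indicator (fun v => ENNReal.ofReal (surv F v)) v)
      k]
  refine lintegral_congr fun t => ?_
  by_cases ht : 0 < t
  · rw [indicator_of_mem (mem_Ioi.2 ht), indicator_of_mem (mem_Ioi.2 (by linarith))]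
  · rw [indicator_of_notMem (by simpa using ht), indicator_of_notMem (by simpa using ht)]

/-- A payment function for the share `0.79`, with scale `x`: constant up to `x`, proportional to
the sample up to `1.29 x`, and of larger slope from there on. -/
def hingePayment (x s : ℝ) : ℝ≥0∞ :=
  ENNReal.ofReal (0.79 * x) + ENNReal.ofReal 0.79 * ENNReal.ofReal (s - x) +
    ENNReal.ofReal 0.0825 * ENNReal.ofReal (s - 1.29 * x)

lemma hingePayment_mono (x : ℝ) : Monotone (hingePayment x) := by
  intro s t hst
  unfold hingePayment
  gcongr

lemma lintegral_hingePayment (F : Dist) (x : ℝ) :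
    ∫⁻ s, hingePayment x s ∂F.law = ENNReal.ofReal (0.79 * x) +
      ENNReal.ofReal 0.79 * (∫⁻ v in Ioi x, ENNReal.ofReal (surv F v)) +
      ENNReal.ofReal 0.0825 * ∫⁻ v in Ioi (1.29 * x), ENNReal.ofReal (surv F v) := by
  unfold hingePayment
  rw [lintegral_add_left (by fun_prop), lintegral_add_left (by fun_prop),
    lintegral_const_mul _ (by fun_prop), lintegral_const_mul _ (by fun_prop), lintegral_excess,
    lintegral_excess]
  simp

lemma le_lintegral_surv_truncExp {c B k : ℝ} (hc : 0 ≤ c) (hB : 0 < B) (hk : 0 ≤ k) :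
    ENNReal.ofReal (max (Real.exp (-(c * k)) - Real.exp (-(c * B))) 0) ≤
      ENNReal.ofReal c * ∫⁻ v in Ioi k, ENNReal.ofReal (surv (truncExp c B hc hB) v) := by
  rcases le_or_gt B k with h | h
  · have : Real.exp (-(c * k)) ≤ Real.exp (-(c * B)) := Real.exp_le_exp.2 (by nlinarith)
    rw [max_eq_right (by linarith)]
    simp
  have h1 : Real.exp (-(c * B)) ≤ Real.exp (-(c * k)) := Real.exp_le_exp.2 (by nlinarith)
  rw [max_eq_left (by linarith), ← lintegral_expDensity hc h.le]
  have hm : Measurable fun v => ENNReal.ofReal (surv (truncExp c B hc hB) v) :=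
    (surv_antitone _).measurable.ennreal_ofReal
  rw [← lintegral_const_mul _ hm]
  calc ∫⁻ s in Ioo k B, ENNReal.ofReal (c * Real.exp (-(c * s)))
      = ∫⁻ v in Ioo k B, ENNReal.ofReal c * ENNReal.ofReal (surv (truncExp c B hc hB) v) := by
        refine setLIntegral_congr_fun measurableSet_Ioo fun v hv => ?_
        rw [surv_truncExp (hk.trans hv.1.le) hv.2.le, ENNReal.ofReal_mul hc]
    _ ≤ _ := lintegral_mono_set Ioo_subset_Ioi_self

/-- Scaling reduces admissibility to rate `1`, that is, to `le_hinge_payment`. -/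
lemma isAdmissible_hingePayment {x : ℝ} (hx : 0 ≤ x) : IsAdmissible 0.79 (hingePayment x) := by
  refine ⟨hingePayment_mono x, fun c B L hc hB hcB hLB hL => ?_⟩
  rcases hc.eq_or_lt with rfl | hc'
  · rw [lintegral_truncExp 0 B (hingePayment_mono x).measurable]
    simp only [zero_mul, neg_zero, Real.exp_zero, mul_one, ENNReal.ofReal_one, one_mul] at hL ⊢
    refine le_trans ?_ le_self_add
    unfold hingePayment
    refine le_trans ?_ le_self_add
    rw [← ENNReal.ofReal_mul (by norm_num)]
    refine le_trans (ENNReal.ofReal_le_ofReal ?_) ENNReal.ofReal_add_le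
    linarith
  have h1 := le_hinge_payment (a := c * B) (x := c * x) (l := c * L) (by positivity) hcB
    (by positivity) (by nlinarith) (by nlinarith)
  have hl := lintegral_hingePayment (truncExp c B hc hB) x
  rw [truncExp_law] at hl
  rw [hl]
  have hc0 : ENNReal.ofReal c ≠ 0 := by simpa using hc'
  rw [← ENNReal.mul_le_mul_iff_right hc0 ENNReal.ofReal_ne_top, ← ENNReal.ofReal_mul hc]
  have k1 := le_lintegral_surv_truncExp hc hB hx
  have k2 := le_lintegral_surv_truncExp hc hB (k := 1.29 * x) (by positivity)
  rw [show c * (1.29 * x) = 1.29 * (c * x) by ring] at k2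
  calc ENNReal.ofReal (c * L) ≤ ENNReal.ofReal (0.79 * (c * x) +
        0.79 * max (Real.exp (-(c * x)) - Real.exp (-(c * B))) 0 +
        0.0825 * max (Real.exp (-(1.29 * (c * x))) - Real.exp (-(c * B))) 0) :=
        ENNReal.ofReal_le_ofReal h1
    _ = ENNReal.ofReal c * ENNReal.ofReal (0.79 * x) +
        ENNReal.ofReal 0.79 *
          ENNReal.ofReal (max (Real.exp (-(c * x)) - Real.exp (-(c * B))) 0) +
        ENNReal.ofReal 0.0825 *
          ENNReal.ofReal (max (Real.exp (-(1.29 * (c * x))) - Real.exp (-(c * B))) 0) := by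
        rw [← ENNReal.ofReal_mul hc, ← ENNReal.ofReal_mul (by norm_num),
          ← ENNReal.ofReal_mul (by norm_num), ← ENNReal.ofReal_add (by positivity) (by positivity),
          ← ENNReal.ofReal_add (by positivity) (by positivity)]
        congr 1
        ring
    _ ≤ ENNReal.ofReal c * ENNReal.ofReal (0.79 * x) +
        ENNReal.ofReal 0.79 * (ENNReal.ofReal c *
          ∫⁻ v in Ioi x, ENNReal.ofReal (surv (truncExp c B hc hB) v)) +
        ENNReal.ofReal 0.0825 * (ENNReal.ofReal c *
          ∫⁻ v in Ioi (1.29 * x), ENNReal.ofReal (surv (truncExp c B hc hB) v)) := by gcongr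
    _ = _ := by ring

/-- Exponential tails bound the expected excess. -/
lemma lintegral_surv_le {F : Dist} {c m k : ℝ} (hc : 0 < c)
    (h : ∀ v, surv F v ≤ Real.exp (-(c * v - m))) :
    ∫⁻ v in Ioi k, ENNReal.ofReal (surv F v) ≤
      ENNReal.ofReal (Real.exp (-(c * k - m)) / c) := by
  have hi := integral_exp_mul_Ioi (a := -c) (by linarith) k
  have hint := integrableOn_exp_mul_Ioi (a := -c) (by linarith) k
  calc ∫⁻ v in Ioi k, ENNReal.ofReal (surv F v)
      ≤ ∫⁻ v in Ioi k, ENNReal.ofReal (Real.exp m * Real.exp (-c * v)) := by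
        refine lintegral_mono fun v => ENNReal.ofReal_le_ofReal ((h v).trans_eq ?_)
        rw [← Real.exp_add]
        ring_nf
    _ = ENNReal.ofReal (∫ v in Ioi k, Real.exp m * Real.exp (-c * v)) := by
        rw [ofReal_integral_eq_lintegral_ofReal (hint.const_mul _)
          (Eventually.of_forall fun v => by positivity)]
    _ = _ := by
        rw [integral_const_mul, hi]
        congr 1
        rw [neg_div_neg_eq, ← mul_div_assoc, ← Real.exp_add]
        ring_nf

/-! ### The share `0.79` is feasible -/

/-- Some price earns the share `0.79`, while a slightly larger one does not. -/
lemma IsMHR.exists_last_price {F : Dist} (hF : IsMHR F) (hO : 0 < OPT F) :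
    ∃ U : ℝ, 0 < U ∧ 0.79 * OPT F ≤ rev F U ∧ rev F (1.0005 * U) < 0.79 * OPT F := by
  obtain ⟨v, hv⟩ := exists_lt_rev (F := F) (x := 0.79 * OPT F) (by linarith)
  have hv0 : 0 < v := pos_of_rev_pos ((by positivity : 0 < 0.79 * OPT F).trans hv)
  obtain ⟨C, hC⟩ := hF.eventually_rev_lt (ε := 0.79 * OPT F) (by positivity)
  have hex : ∃ n : ℕ, rev F (1.0005 ^ n * v) < 0.79 * OPT F := by
    have ht : Tendsto (fun n : ℕ => (1.0005 : ℝ) ^ n * v) atTop atTop :=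
      (tendsto_pow_atTop_atTop_of_one_lt (by norm_num)).atTop_mul_const hv0
    obtain ⟨n, hn⟩ := (ht.eventually_ge_atTop C).exists
    exact ⟨n, hC _ hn⟩
  classical
  have hspec := Nat.find_spec hex
  have hmin := fun k => Nat.find_min hex (m := k)
  cases hn : Nat.find hex with
  | zero =>
    rw [hn] at hspec
    simp only [pow_zero, one_mul] at hspec
    linarith
  | succ k =>
    rw [hn] at hspec hmin
    refine ⟨1.0005 ^ k * v, by positivity, not_lt.1 (hmin k (Nat.lt_succ_self k)), ?_⟩
    rwa [pow_succ, mul_comm ((1.0005 : ℝ) ^ k), mul_assoc] at hspec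

/-- The payment function is a hinge payment whose first kink lies slightly beyond the point where
the supporting exponential function of the survival function leaves `1`. -/
lemma feasible_lower : Feasible 0.79 := by
  intro F hF hO
  obtain ⟨U, hU, hrev, hlt⟩ := hF.exists_last_price hO
  set w := 1.0005 * U with hw
  have hUw : U < w := by rw [hw]; linarith
  have hw0 : 0 < w := hU.trans hUw
  rcases le_or_gt 1 (F.cdf w) with hc1 | hc1
  · -- the support is bounded by `w`
    refine ⟨hingePayment U, isAdmissible_hingePayment hU.le, U, hrev, ?_⟩
    have hS : ∀ v, w < v → surv F v = 0 := fun v hv =>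
      le_antisymm (by have := surv_le_one_sub_cdf F hv; linarith) (surv_nonneg _ _)
    have h1 : ∫⁻ v in Ioi U, ENNReal.ofReal (surv F v) ≤ ENNReal.ofReal (w - U) := by
      calc ∫⁻ v in Ioi U, ENNReal.ofReal (surv F v)
          ≤ ∫⁻ v in Ioi U, (Ioc U w).indicator 1 v := by
            refine setLIntegral_mono' measurableSet_Ioi fun v hUv => ?_
            by_cases hv : v ∈ Ioc U w
            · rw [indicator_of_mem hv, Pi.one_apply, ENNReal.ofReal_le_one]
              exact surv_le_one F v
            · rw [indicator_of_notMem hv]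
              rw [hS v (not_le.1 fun h => hv ⟨hUv, h⟩), ENNReal.ofReal_zero]
        _ ≤ ∫⁻ v, (Ioc U w).indicator 1 v := lintegral_mono' Measure.restrict_le_self le_rfl
        _ = _ := by rw [lintegral_indicator_one measurableSet_Ioc, Real.volume_Ioc]
    have h2 : ∫⁻ v in Ioi (1.29 * U), ENNReal.ofReal (surv F v) = 0 := by
      rw [setLIntegral_congr_fun (g := fun _ => 0) measurableSet_Ioi]
      · simp
      · intro v hv
        have : w < v := lt_trans (by rw [hw]; linarith) (mem_Ioi.1 hv)
        simp [hS v this]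
    rw [lintegral_hingePayment, h2, mul_zero, add_zero]
    calc ENNReal.ofReal (0.79 * U) + ENNReal.ofReal 0.79 * ∫⁻ v in Ioi U, ENNReal.ofReal (surv F v)
        ≤ ENNReal.ofReal (0.79 * U) + ENNReal.ofReal 0.79 * ENNReal.ofReal (w - U) := by gcongr
      _ = ENNReal.ofReal (0.79 * U + 0.79 * (w - U)) := by
          rw [← ENNReal.ofReal_mul (by norm_num), ← ENNReal.ofReal_add (by positivity)]
          exact mul_nonneg (by norm_num) (by linarith)
      _ ≤ ENNReal.ofReal U := ENNReal.ofReal_le_ofReal (by rw [hw]; linarith)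
  · -- the supporting exponential function at `w`, of rate `c > 1 / w`
    obtain ⟨c, hc, hs⟩ := hF.exists_supporting hc1
    have hSw : 0 < surv F w := by
      have := one_sub_cdf_le_surv F w
      linarith
    have hcw : 1 < c * w := by
      have h1 : w * surv F w < U * (surv F w * Real.exp (-(c * (U - w)))) :=
        (hlt.trans_le hrev).trans_le (mul_le_mul_of_nonneg_left (hs U) hU.le)
      have h2 : w < U * Real.exp (c * (w - U)) := by
        refine lt_of_mul_lt_mul_right (lt_of_lt_of_eq h1 ?_) hSw.le
        ring_nf
      have h3 := exp_neg_ge_one (x := c * (w - U))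
      have h4 : w * Real.exp (-(c * (w - U))) < U := by
        calc w * Real.exp (-(c * (w - U)))
            < U * Real.exp (c * (w - U)) * Real.exp (-(c * (w - U))) :=
              mul_lt_mul_of_pos_right h2 (Real.exp_pos _)
          _ = U := by rw [mul_assoc, ← Real.exp_add]; simp
      have h5 : w * (1 - c * (w - U)) < U := (mul_le_mul_of_nonneg_left h3 hw0.le).trans_lt h4
      have h6 : 0 < (w - U) * (c * w - 1) := by linarith
      have := pos_of_mul_pos_right h6 (by linarith)
      linarith
    have hc0 : 0 < c := by
      by_contra h
      have : c * w ≤ 0 := mul_nonpos_of_nonpos_of_nonneg (not_lt.1 h) hw0.le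
      linarith
    set m := c * w + Real.log (surv F w) with hm
    have hsm : ∀ v, surv F w * Real.exp (-(c * (v - w))) = Real.exp (-(c * v - m)) := by
      intro v
      nth_rewrite 1 [← Real.exp_log hSw]
      rw [← Real.exp_add, hm]
      ring_nf
    have hs' : ∀ v, surv F v ≤ Real.exp (-(c * v - m)) := fun v => (hs v).trans_eq (hsm v)
    have hm0 : 0 ≤ m := by
      have h1 := hs' 0
      rw [surv_of_nonpos F le_rfl] at h1
      have h2 : 0 ≤ -(c * 0 - m) := by
        by_contra h
        have := Real.exp_lt_one_iff.2 (not_le.1 h)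
        linarith
      linarith
    have hmw : m ≤ c * w := by
      have := Real.log_nonpos hSw.le (surv_le_one F w)
      linarith
    have hy : c * w * Real.exp (-(c * w - m)) < 0.79 * (c * OPT F) := by
      have h1 := hsm w
      rw [sub_self, mul_zero, neg_zero, Real.exp_zero, mul_one] at h1
      rw [← h1]
      have := mul_lt_mul_of_pos_left hlt hc0
      rw [rev] at this
      linarith
    have hopt : ∀ X, 0 ≤ X → (∀ z, 0 < z → z * min 1 (Real.exp (-(z - m))) ≤ X) →
        c * OPT F ≤ X := by
      intro X hX h
      rw [← le_div_iff₀' hc0]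
      refine ciSup_le fun v => ?_
      rw [le_div_iff₀' hc0]
      rcases le_or_gt v 0 with hv | hv
      · exact (mul_nonpos_of_nonneg_of_nonpos hc0.le
          (mul_nonpos_of_nonpos_of_nonneg hv (surv_nonneg F v))).trans hX
      · refine le_trans ?_ (h (c * v) (by positivity))
        rw [← mul_assoc]
        exact mul_le_mul_of_nonneg_left (le_min (surv_le_one F v) (hs' v)) (by positivity)
    have hprice := hinge_price_le hm0 hcw.le hmw
      (fun hm1 => hy.trans_le (mul_le_mul_of_nonneg_left (hopt _ (Real.exp_pos _).le fun z hz => by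
        have h1 := Real.add_one_le_exp (z - 1)
        calc z * min 1 (Real.exp (-(z - m))) ≤ Real.exp (z - 1) * Real.exp (-(z - m)) :=
              mul_le_mul (by linarith) (min_le_right _ _) (by positivity) (Real.exp_pos _).le
          _ = _ := by rw [← Real.exp_add]; ring_nf) (by norm_num)))
      (fun hm1 => hy.trans_le (mul_le_mul_of_nonneg_left (hopt _ hm0 fun z hz => by
        rcases le_total z m with h | h
        · exact (mul_le_of_le_one_right hz.le (min_le_left _ _)).trans h
        · have h1 := Real.add_one_le_exp (z - m)
          have h2 : z ≤ m * Real.exp (z - m) := by nlinarith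
          calc z * min 1 (Real.exp (-(z - m))) ≤ m * Real.exp (z - m) * Real.exp (-(z - m)) :=
                mul_le_mul h2 (min_le_right _ _) (by positivity) (by positivity)
            _ = m := by rw [mul_assoc, ← Real.exp_add]; simp) (by norm_num)))
    set x := (m + 0.077) / c with hx
    have hx0 : 0 ≤ x := by positivity
    have hcx : c * x = m + 0.077 := by rw [hx]; field_simp
    refine ⟨hingePayment x, isAdmissible_hingePayment hx0, U, hrev, ?_⟩
    have t1 := lintegral_surv_le (k := x) hc0 hs'
    have t2 := lintegral_surv_le (k := 1.29 * x) hc0 hs'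
    rw [show c * x - m = 0.077 by linarith] at t1
    rw [show c * (1.29 * x) - m = 1.29 * 0.077 + 0.29 * m by linarith] at t2
    rw [lintegral_hingePayment]
    calc _ ≤ ENNReal.ofReal (0.79 * x) + ENNReal.ofReal 0.79 *
          ENNReal.ofReal (Real.exp (-0.077) / c) + ENNReal.ofReal 0.0825 *
          ENNReal.ofReal (Real.exp (-(1.29 * 0.077 + 0.29 * m)) / c) := by gcongr
      _ = ENNReal.ofReal (0.79 * x + 0.79 * (Real.exp (-0.077) / c) +
          0.0825 * (Real.exp (-(1.29 * 0.077 + 0.29 * m)) / c)) := by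
          rw [← ENNReal.ofReal_mul (by norm_num), ← ENNReal.ofReal_mul (by norm_num),
            ← ENNReal.ofReal_add (by positivity) (by positivity),
            ← ENNReal.ofReal_add (by positivity) (by positivity)]
      _ ≤ ENNReal.ofReal U := by
          refine ENNReal.ofReal_le_ofReal ?_
          rw [← mul_le_mul_iff_right₀ hc0]
          have e : c * (0.79 * x + 0.79 * (Real.exp (-0.077) / c) +
              0.0825 * (Real.exp (-(1.29 * 0.077 + 0.29 * m)) / c)) =
              0.79 * (c * x) + 0.79 * Real.exp (-0.077) +
              0.0825 * Real.exp (-(1.29 * 0.077 + 0.29 * m)) := by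
            field_simp
          rw [e, hcx]
          have : c * w = 1.0005 * (c * U) := by rw [hw]; ring
          linarith

/-! ### Shifted exponential distributions -/

/-- The law of `m + X` for an exponential variable `X` with rate `1`. -/
def shiftedExpMeasure (m : ℝ) : Measure ℝ :=
  (volume.restrict (Ioi m)).withDensity fun s => ENNReal.ofReal (Real.exp (m - s))

lemma lintegral_shiftedExp (m : ℝ) {g : ℝ → ℝ≥0∞} (hg : Measurable g) :
    ∫⁻ s, g s ∂shiftedExpMeasure m =
      ENNReal.ofReal (Real.exp m) * ∫⁻ s in Ioi m, ENNReal.ofReal (Real.exp (-s)) * g s := by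
  rw [shiftedExpMeasure, lintegral_withDensity_eq_lintegral_mul _ (by fun_prop) hg,
    ← lintegral_const_mul _ (by fun_prop)]
  refine lintegral_congr fun s => ?_
  rw [Pi.mul_apply, ← mul_assoc, ← ENNReal.ofReal_mul (Real.exp_pos _).le, ← Real.exp_add]
  rfl

lemma shiftedExp_apply {m v : ℝ} {A : Set ℝ} (hA : MeasurableSet A)
    (h : (A ∩ Ioi m : Set ℝ) =ᵐ[volume] Ioi v) :
    shiftedExpMeasure m A = ENNReal.ofReal (Real.exp (m - v)) := by
  rw [shiftedExpMeasure, withDensity_apply _ hA, Measure.restrict_restrict hA,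
    Measure.restrict_congr_set h, ← ofReal_integral_eq_lintegral_ofReal]
  · simp_rw [sub_eq_add_neg, Real.exp_add]
    rw [integral_const_mul, integral_exp_neg_Ioi]
  · simp_rw [sub_eq_add_neg, Real.exp_add]
    exact (integrableOn_exp_neg_Ioi v).const_mul _
  · exact Eventually.of_forall fun s => (Real.exp_pos _).le

lemma shiftedExp_Ioi {m v : ℝ} (hv : m ≤ v) :
    shiftedExpMeasure m (Ioi v) = ENNReal.ofReal (Real.exp (m - v)) := by
  refine shiftedExp_apply measurableSet_Ioi ?_
  exact EventuallyEq.of_eq (inter_eq_left.2 (Ioi_subset_Ioi hv))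

lemma shiftedExp_Ici {m v : ℝ} (hv : m ≤ v) :
    shiftedExpMeasure m (Ici v) = ENNReal.ofReal (Real.exp (m - v)) := by
  refine shiftedExp_apply measurableSet_Ici ?_
  refine (Ioi_ae_eq_Ici.symm.inter (EventuallyEq.refl _ (Ioi m))).trans ?_
  exact EventuallyEq.of_eq (inter_eq_left.2 (Ioi_subset_Ioi hv))

lemma shiftedExp_univ (m : ℝ) : shiftedExpMeasure m univ = 1 := by
  rw [shiftedExp_apply MeasurableSet.univ (EventuallyEq.of_eq (univ_inter _))]
  simp

/-- The shifted exponential distribution as a value distribution. -/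
def shiftedExp (m : ℝ) (hm : 0 ≤ m) : Dist :=
  ⟨shiftedExpMeasure m, ⟨shiftedExp_univ m⟩, by
    have : IsProbabilityMeasure (shiftedExpMeasure m) := ⟨shiftedExp_univ m⟩
    refine measure_mono_null (Iio_subset_Iio hm) ?_
    rw [← compl_Ici, prob_compl_eq_zero_iff measurableSet_Ici, shiftedExp_Ici le_rfl]
    simp⟩

section

variable {m : ℝ} {hm : 0 ≤ m}

lemma shiftedExp_law : (shiftedExp m hm).law = shiftedExpMeasure m := rfl

lemma surv_shiftedExp {v : ℝ} (hv : m ≤ v) : surv (shiftedExp m hm) v = Real.exp (m - v) := by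
  rw [surv, measureReal_def, shiftedExp_law, shiftedExp_Ici hv,
    ENNReal.toReal_ofReal (Real.exp_pos _).le]

lemma surv_shiftedExp_le (v : ℝ) : surv (shiftedExp m hm) v ≤ Real.exp (m - v) := by
  rcases le_total m v with h | h
  · exact (surv_shiftedExp h).le
  · exact (surv_le_one _ v).trans (Real.one_le_exp (by linarith))

lemma one_sub_cdf_shiftedExp {v : ℝ} (hv : m ≤ v) :
    1 - (shiftedExp m hm).cdf v = Real.exp (m - v) := by
  rw [one_sub_cdf, measureReal_def, shiftedExp_law, shiftedExp_Ioi hv,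
    ENNReal.toReal_ofReal (Real.exp_pos _).le]

lemma isMHR_shiftedExp : IsMHR (shiftedExp m hm) := by
  have hset : {v | (shiftedExp m hm).cdf v < 1} = univ := by
    refine eq_univ_of_forall fun v => ?_
    have h1 := one_sub_cdf_shiftedExp (hm := hm) (le_max_left m v)
    have h2 := cdf_mono (shiftedExp m hm) (le_max_right m v)
    have h3 := Real.exp_pos (m - max m v)
    change (shiftedExp m hm).cdf v < 1
    linarith
  rw [IsMHR, hset]
  refine ⟨(Ioi m).indicator fun v => Real.exp (m - v), fun v => ?_, ?_, ?_⟩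
  · exact indicator_nonneg (fun v _ => (Real.exp_pos _).le) v
  · have : (fun v => ENNReal.ofReal ((Ioi m).indicator (fun v => Real.exp (m - v)) v)) =
        (Ioi m).indicator fun v => ENNReal.ofReal (Real.exp (m - v)) := by
      ext v
      by_cases hv : v ∈ Ioi m <;> simp [hv]
    rw [this, withDensity_indicator measurableSet_Ioi, Measure.restrict_univ,
      Measure.restrict_univ]
    rfl
  · intro u _ w _ huw
    have hval : ∀ v, m < v → (Ioi m).indicator (fun v => Real.exp (m - v)) v /
        (1 - (shiftedExp m hm).cdf v) = 1 := by
      intro v hv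
      rw [one_sub_cdf_shiftedExp hv.le, indicator_of_mem (mem_Ioi.2 hv),
        div_self (Real.exp_pos _).ne']
    have hval0 : ∀ v, v ≤ m → (Ioi m).indicator (fun v => Real.exp (m - v)) v /
        (1 - (shiftedExp m hm).cdf v) = 0 := by
      intro v hv
      rw [indicator_of_notMem (by simpa using hv), zero_div]
    rcases le_or_gt u m with h | h
    · rcases le_or_gt w m with h' | h'
      · simp only [hval0 u h, hval0 w h', le_refl]
      · simp only [hval0 u h, hval w h', zero_le_one]
    · simp only [hval u h, hval w (h.trans_le huw), le_refl]

lemma le_OPT_shiftedExp : m ≤ OPT (shiftedExp m hm) := by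
  have hb : BddAbove (range (rev (shiftedExp m hm))) := by
    refine ⟨Real.exp m, ?_⟩
    rintro _ ⟨v, rfl⟩
    rcases le_or_gt v 0 with h | h
    · exact (mul_nonpos_of_nonpos_of_nonneg h (surv_nonneg _ _)).trans (Real.exp_pos _).le
    · calc v * surv (shiftedExp m hm) v ≤ Real.exp v * Real.exp (m - v) :=
            mul_le_mul (by linarith [Real.add_one_le_exp v]) (surv_shiftedExp_le v)
              (surv_nonneg _ _) (Real.exp_pos _).le
        _ = Real.exp m := by rw [← Real.exp_add]; ring_nf
  have : rev (shiftedExp m hm) m ≤ OPT (shiftedExp m hm) := le_ciSup hb m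
  rwa [rev, surv_shiftedExp le_rfl, sub_self, Real.exp_zero, mul_one] at this

end

/-! ### Averaging over truncation points -/

lemma lintegral_ofReal_of_hasDerivAt {f F : ℝ → ℝ} {u w : ℝ} (h : u ≤ w)
    (hF : ∀ x, HasDerivAt F (f x) x) (hf : Continuous f) (h0 : ∀ x, u ≤ x → x ≤ w → 0 ≤ f x) :
    ∫⁻ x in Ioc u w, ENNReal.ofReal (f x) = ENNReal.ofReal (F w - F u) := by
  rw [← intervalIntegral.integral_eq_sub_of_hasDerivAt (fun x _ => hF x)
    (hf.intervalIntegrable _ _), intervalIntegral.integral_of_le h,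
    ofReal_integral_eq_lintegral_ofReal]
  · exact hf.integrableOn_Icc.mono_set Ioc_subset_Icc_self
  · filter_upwards [ae_restrict_mem measurableSet_Ioc] with x hx
    exact h0 x hx.1.le hx.2

/-- Averaging the truncated exponential distributions of rate `α` over truncation points in `(b, c)`
with the density `β exp (-β B)`. When `α + β = 1`, the atoms and the densities add up to the
exponential density of rate `1` on `(b, c)`. -/
lemma lintegral_truncExp_average {α β b c : ℝ} (hα : 0 ≤ α) (hβ : 0 ≤ β) (hαβ : α + β = 1)
    (hb : 0 ≤ b) {g : ℝ → ℝ≥0∞} (hg : Measurable g) :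
    ∫⁻ B in Ioo b c, ENNReal.ofReal (β * Real.exp (-(β * B))) *
        ∫⁻ s, g s ∂truncExpMeasure α B ≤
      (∫⁻ s in Ioo b c, ENNReal.ofReal (Real.exp (-s)) * g s) +
        ∫⁻ s in Ioc 0 b, ENNReal.ofReal (α * Real.exp (-(α * s)) * Real.exp (-(β * b))) * g s := by
  set p : ℝ → ℝ≥0∞ := fun s => ENNReal.ofReal (α * Real.exp (-(α * s))) with hp
  set q : ℝ → ℝ≥0∞ := fun B => ENNReal.ofReal (β * Real.exp (-(β * B))) with hq
  have hpm : Measurable p := measurable_expDensity α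
  have hqm : Measurable q := measurable_expDensity β
  have hpg : Measurable fun s => p s * g s := hpm.mul hg
  -- the mass of the truncation points beyond `s`
  have h0 : ∀ s, ∫⁻ B in Ioo b c, (Ioi s).indicator q B ≤
      (Iio c).indicator (fun s => ENNReal.ofReal (Real.exp (-(β * max b s)))) s := by
    intro s
    rw [setLIntegral_indicator measurableSet_Ioi, Ioi_inter_Ioo, max_comm]
    rcases le_or_gt c (max b s) with h | h
    · rw [Ioo_eq_empty (not_lt.2 h)]
      simp
    · rw [lintegral_expDensity hβ h.le,
        indicator_of_mem (mem_Iio.2 ((le_max_right b s).trans_lt h))]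
      exact ENNReal.ofReal_le_ofReal (sub_le_self _ (Real.exp_pos _).le)
  -- the contribution of the densities, by Tonelli's theorem
  have h1 : ∫⁻ B in Ioo b c, q B * ∫⁻ s in Ioo 0 B, p s * g s =
      ∫⁻ s in Ioi 0, p s * g s * ∫⁻ B in Ioo b c, (Ioi s).indicator q B := by
    have hk : Measurable fun z : ℝ × ℝ => p z.2 * g z.2 * (Ioi z.2).indicator q z.1 := by
      have hs : MeasurableSet {z : ℝ × ℝ | z.2 < z.1} :=
        measurableSet_lt measurable_snd measurable_fst
      exact (hpg.comp measurable_snd).mul ((hqm.comp measurable_fst).indicator hs)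
    calc ∫⁻ B in Ioo b c, q B * ∫⁻ s in Ioo 0 B, p s * g s
        = ∫⁻ B in Ioo b c, ∫⁻ s in Ioi 0, p s * g s * (Ioi s).indicator q B := by
          refine lintegral_congr fun B => ?_
          rw [← lintegral_const_mul _ hpg, ← lintegral_indicator measurableSet_Ioo,
            ← lintegral_indicator measurableSet_Ioi]
          refine lintegral_congr fun s => ?_
          by_cases h0 : 0 < s <;> by_cases hB : s < B <;> simp [h0, hB, mul_comm]
      _ = ∫⁻ s in Ioi 0, ∫⁻ B in Ioo b c, p s * g s * (Ioi s).indicator q B :=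
          lintegral_lintegral_swap hk.aemeasurable
      _ = _ := lintegral_congr fun s =>
          lintegral_const_mul _ (hqm.indicator measurableSet_Ioi)
  have h2 : ∫⁻ s in Ioi 0, p s * g s * ∫⁻ B in Ioo b c, (Ioi s).indicator q B ≤
      (∫⁻ s in Ioc 0 b, ENNReal.ofReal (α * Real.exp (-(α * s)) * Real.exp (-(β * b))) * g s) +
        ∫⁻ s in Ioo b c, ENNReal.ofReal (α * Real.exp (-s)) * g s := by
    have hu : Ioi (0 : ℝ) = Ioc 0 b ∪ Ioi b := (Ioc_union_Ioi_eq_Ioi hb).symm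
    rw [hu, lintegral_union measurableSet_Ioi
      (disjoint_left.2 fun x hx hx' => absurd hx.2 (not_le.2 hx'))]
    refine add_le_add (setLIntegral_mono' measurableSet_Ioc fun s hs => ?_) ?_
    · refine (mul_le_mul_right ((h0 s).trans (indicator_le_self _ _ _)) _).trans_eq ?_
      rw [max_eq_left hs.2, mul_right_comm, hp, ← ENNReal.ofReal_mul (by positivity)]
    · rw [← lintegral_indicator measurableSet_Ioo, ← lintegral_indicator measurableSet_Ioi]
      refine lintegral_mono fun s => ?_
      by_cases hs : b < s
      · rw [indicator_of_mem (mem_Ioi.2 hs)]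
        refine (mul_le_mul_right (h0 s) _).trans ?_
        by_cases hc : s < c
        · rw [indicator_of_mem (mem_Iio.2 hc), indicator_of_mem (show s ∈ Ioo b c from ⟨hs, hc⟩),
            max_eq_right hs.le, mul_right_comm, hp, ← ENNReal.ofReal_mul (by positivity),
            mul_assoc α, ← Real.exp_add, ← neg_add, ← add_mul, hαβ, one_mul]
        · rw [indicator_of_notMem (by simpa using hc), mul_zero]
          exact zero_le
      · rw [indicator_of_notMem (by simpa using hs)]
        exact zero_le
  have hm : Measurable fun B => q B * (ENNReal.ofReal (Real.exp (-(α * B))) * g B) :=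
    hqm.mul (Measurable.mul (by fun_prop) hg)
  calc ∫⁻ B in Ioo b c, q B * ∫⁻ s, g s ∂truncExpMeasure α B
      = (∫⁻ B in Ioo b c, q B * (ENNReal.ofReal (Real.exp (-(α * B))) * g B)) +
          ∫⁻ B in Ioo b c, q B * ∫⁻ s in Ioo 0 B, p s * g s := by
        rw [← lintegral_add_left hm]
        refine lintegral_congr fun B => ?_
        rw [lintegral_truncExp α B hg, mul_add]
    _ ≤ (∫⁻ s in Ioo b c, ENNReal.ofReal (β * Real.exp (-s)) * g s) +
        ((∫⁻ s in Ioc 0 b, ENNReal.ofReal (α * Real.exp (-(α * s)) * Real.exp (-(β * b))) * g s) +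
        ∫⁻ s in Ioo b c, ENNReal.ofReal (α * Real.exp (-s)) * g s) := by
        refine add_le_add (le_of_eq (lintegral_congr fun B => ?_)) (h1.trans_le h2)
        rw [← mul_assoc, hq, ← ENNReal.ofReal_mul (by positivity), mul_assoc β, ← Real.exp_add,
          ← neg_add, ← add_mul, add_comm β, hαβ, one_mul]
    _ = _ := by
        rw [add_comm (∫⁻ s in Ioc 0 b, _), ← add_assoc, ← lintegral_add_left (by fun_prop)]
        congr 1
        refine lintegral_congr fun s => ?_
        rw [← add_mul, ← ENNReal.ofReal_add (by positivity) (by positivity), ← add_mul,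
          add_comm β, hαβ, one_mul]

lemma lintegral_Ioc_add {f : ℝ → ℝ≥0∞} {u v w : ℝ} (huv : u ≤ v) (hvw : v ≤ w) :
    ∫⁻ x in Ioc u w, f x = (∫⁻ x in Ioc u v, f x) + ∫⁻ x in Ioc v w, f x := by
  rw [← Ioc_union_Ioc_eq_Ioc huv hvw, lintegral_union measurableSet_Ioc
    (disjoint_left.2 fun x hx hx' => absurd hx.2 (not_le.2 hx'.1))]

/-- The bounds coming from point masses. -/
lemma IsAdmissible.ofReal_le {Γ : ℝ} (hΓ1 : Γ ≤ 1) {g : ℝ → ℝ≥0∞}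
    (hg : IsAdmissible Γ g) {s : ℝ} (hs : 0 < s) : ENNReal.ofReal (Γ * s) ≤ g s := by
  have h1 : ∀ L < Γ * s, ENNReal.ofReal L ≤ g s := by
    intro L hL
    have h2 := hg.le_lintegral 0 s L le_rfl hs (by simp) (by nlinarith) (by simpa using hL)
    rw [lintegral_truncExp 0 s hg.mono.measurable] at h2
    simpa using h2
  refine le_of_tendsto (f := ENNReal.ofReal) (x := 𝓝[<] (Γ * s))
    (ENNReal.continuous_ofReal.continuousWithinAt) ?_
  filter_upwards [self_mem_nhdsWithin] with L hL using h1 L hL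

/-- A lower bound for the expected payment under shifted exponential distributions: the payments
in `(b, c)` are bounded from below through an average of truncated exponential distributions,
at the expense of payments below `b`. Of the latter, those in `(s₀, b]` have positive net weight and
are bounded from below through point masses; for those up to `s₀` the negative net weight on
`(0, m]` is outweighed by the positive one on `(m, s₀]`, as payments are nondecreasing. -/
lemma IsAdmissible.le_lintegral_exp {Γ : ℝ} {g : ℝ → ℝ≥0∞} (hg : IsAdmissible Γ g)
    {α β b c s₀ m : ℝ} (hα : 0 ≤ α) (hβ : 0 ≤ β) (hαβ : α + β = 1) (hm : 0 ≤ m) (hms : m ≤ s₀)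
    (hsb : s₀ ≤ b) (hΓ1 : Γ ≤ 1) {L : ℝ → ℝ}
    (hLB : ∀ B, b < B → B < c → ENNReal.ofReal (L B) ≤ ∫⁻ s, g s ∂truncExpMeasure α B)
    (hcancel : Real.exp (-(β * b)) * (1 - Real.exp (-(α * s₀))) ≤ Real.exp (-m) - Real.exp (-s₀)) :
    (∫⁻ B in Ioo b c, ENNReal.ofReal (β * Real.exp (-(β * B)) * L B)) +
      (∫⁻ s in Ioc s₀ b, ENNReal.ofReal
        (Γ * (s * (Real.exp (-s) - α * Real.exp (-(α * s)) * Real.exp (-(β * b)))))) ≤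
      ∫⁻ s in Ioi m, ENNReal.ofReal (Real.exp (-s)) * g s := by
  have hgm : Measurable g := hg.mono.measurable
  have hα1 : α ≤ 1 := by linarith
  set K : ℝ → ℝ := fun s => α * Real.exp (-(α * s)) * Real.exp (-(β * b)) with hK
  have hK0 : ∀ s, 0 ≤ K s := fun s => by positivity
  have hKm : Measurable fun s => ENNReal.ofReal (K s) * g s := Measurable.mul (by fun_prop) hgm
  have hKE : ∀ s, s ≤ b → K s ≤ Real.exp (-s) := by
    intro s hs
    calc K s = α * Real.exp (-(α * s) + -(β * b)) := by rw [Real.exp_add]; exact mul_assoc _ _ _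
      _ ≤ 1 * Real.exp (-s) := by
          refine mul_le_mul hα1 (Real.exp_le_exp.2 ?_) (Real.exp_pos _).le zero_le_one
          have : s = α * s + β * s := by rw [← add_mul, hαβ, one_mul]
          nlinarith [mul_le_mul_of_nonneg_left hs hβ]
      _ = _ := one_mul _
  have hadd : ∀ s, s ≤ b → ENNReal.ofReal (Real.exp (-s) - K s) + ENNReal.ofReal (K s) =
      ENNReal.ofReal (Real.exp (-s)) := by
    intro s hs
    rw [← ENNReal.ofReal_add (by linarith [hKE s hs]) (hK0 s), sub_add_cancel]
  have hKd : ∀ s, HasDerivAt (fun s => -(Real.exp (-(β * b)) * Real.exp (-(α * s)))) (K s) s := by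
    intro s
    have h1 : HasDerivAt (fun s => -(α * s)) (-(α * 1)) s := ((hasDerivAt_id s).const_mul α).neg
    refine (h1.exp.const_mul (Real.exp (-(β * b)))).neg.congr_deriv ?_
    rw [hK]
    ring
  have hKc : Continuous K := by fun_prop
  -- the average over truncation points
  have hX : ∫⁻ B in Ioo b c, ENNReal.ofReal (β * Real.exp (-(β * B)) * L B) ≤
      (∫⁻ s in Ioo b c, ENNReal.ofReal (Real.exp (-s)) * g s) +
        ∫⁻ s in Ioc 0 b, ENNReal.ofReal (K s) * g s := by
    refine le_trans (setLIntegral_mono' measurableSet_Ioo fun B hB => ?_)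
      (lintegral_truncExp_average hα hβ hαβ (hm.trans (hms.trans hsb)) hgm)
    rw [ENNReal.ofReal_mul (by positivity)]
    exact mul_le_mul_right (hLB B hB.1 hB.2) _
  -- payments up to `s₀`: the weight on `(0, m]` is at most the spare weight on `(m, s₀]`
  have h1 : (∫⁻ s in Ioc 0 m, ENNReal.ofReal (K s) * g s) +
      (∫⁻ s in Ioc m s₀, ENNReal.ofReal (K s) * g s) ≤
      ∫⁻ s in Ioc m s₀, ENNReal.ofReal (Real.exp (-s)) * g s := by
    have h2 : ∫⁻ s in Ioc 0 m, ENNReal.ofReal (K s) * g s ≤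
        ∫⁻ s in Ioc m s₀, ENNReal.ofReal (Real.exp (-s) - K s) * g s := by
      calc ∫⁻ s in Ioc 0 m, ENNReal.ofReal (K s) * g s
          ≤ ∫⁻ s in Ioc 0 m, ENNReal.ofReal (K s) * g m :=
            setLIntegral_mono' measurableSet_Ioc fun s hs => mul_le_mul_right (hg.mono hs.2) _
        _ = ENNReal.ofReal (-(Real.exp (-(β * b)) * Real.exp (-(α * m))) -
              -(Real.exp (-(β * b)) * Real.exp (-(α * 0)))) * g m := by
            rw [lintegral_mul_const _ (by fun_prop),
              lintegral_ofReal_of_hasDerivAt hm hKd hKc fun s _ _ => hK0 s]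
        _ ≤ ENNReal.ofReal ((-Real.exp (-s₀) - -(Real.exp (-(β * b)) * Real.exp (-(α * s₀)))) -
              (-Real.exp (-m) - -(Real.exp (-(β * b)) * Real.exp (-(α * m))))) * g m := by
            refine mul_le_mul_left (ENNReal.ofReal_le_ofReal ?_) _
            rw [mul_zero, neg_zero, Real.exp_zero]
            linarith
        _ = ∫⁻ s in Ioc m s₀, ENNReal.ofReal (Real.exp (-s) - K s) * g m := by
            rw [lintegral_mul_const _ (by fun_prop), lintegral_ofReal_of_hasDerivAt hms
              (F := fun s => -Real.exp (-s) - -(Real.exp (-(β * b)) * Real.exp (-(α * s))))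
              (fun s => ((hasDerivAt_exp_neg s).neg.congr_deriv (by ring)).sub (hKd s))
              (by fun_prop) fun s _ hs => by linarith [hKE s (hs.trans hsb)]]
        _ ≤ _ := setLIntegral_mono' measurableSet_Ioc fun s hs =>
            mul_le_mul_right (hg.mono hs.1.le) _
    refine (add_le_add_left h2 _).trans_eq ?_
    rw [← lintegral_add_right _ hKm]
    refine setLIntegral_congr_fun measurableSet_Ioc fun s hs => ?_
    rw [← add_mul, hadd s (hs.2.trans hsb)]
  -- payments on `(s₀, b]`
  have h2 : (∫⁻ s in Ioc s₀ b, ENNReal.ofReal (K s) * g s) +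
      (∫⁻ s in Ioc s₀ b, ENNReal.ofReal (Γ * (s * (Real.exp (-s) - K s)))) ≤
      ∫⁻ s in Ioc s₀ b, ENNReal.ofReal (Real.exp (-s)) * g s := by
    rw [← lintegral_add_left hKm]
    refine setLIntegral_mono' measurableSet_Ioc fun s hs => ?_
    have h3 := hg.ofReal_le hΓ1 ((hm.trans hms).trans_lt hs.1)
    rw [← hadd s hs.2, add_mul, add_comm, ← mul_assoc, mul_comm,
      ENNReal.ofReal_mul (by linarith [hKE s hs.2])]
    gcongr
  have hE : ∫⁻ s in Ioi m, ENNReal.ofReal (Real.exp (-s)) * g s ≥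
      (∫⁻ s in Ioo b c, ENNReal.ofReal (Real.exp (-s)) * g s) +
      ((∫⁻ s in Ioc m s₀, ENNReal.ofReal (Real.exp (-s)) * g s) +
        ∫⁻ s in Ioc s₀ b, ENNReal.ofReal (Real.exp (-s)) * g s) := by
    rw [← lintegral_Ioc_add hms hsb, ← Ioc_union_Ioi_eq_Ioi (hms.trans hsb),
      lintegral_union measurableSet_Ioi
        (disjoint_left.2 fun x hx hx' => absurd hx.2 (not_le.2 hx')), add_comm]
    exact add_le_add_left (lintegral_mono_set Ioo_subset_Ioi_self) _
  refine le_trans (add_le_add_left hX _) (le_trans ?_ hE)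
  rw [lintegral_Ioc_add hm (hms.trans hsb), lintegral_Ioc_add hms hsb]
  calc _ = (∫⁻ s in Ioo b c, ENNReal.ofReal (Real.exp (-s)) * g s) +
        (((∫⁻ s in Ioc 0 m, ENNReal.ofReal (K s) * g s) +
          ∫⁻ s in Ioc m s₀, ENNReal.ofReal (K s) * g s) +
        ((∫⁻ s in Ioc s₀ b, ENNReal.ofReal (K s) * g s) +
          ∫⁻ s in Ioc s₀ b, ENNReal.ofReal (Γ * (s * (Real.exp (-s) - K s))))) := by ring
    _ ≤ _ := by gcongr

/-! ### The share `0.796` is not feasible -/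

/-- Under the truncated exponential distribution with rate `1` and truncation point `a`, the price
`z` falls short of the share `0.796`. -/
lemma cubic_price_lt {a z : ℝ} (h0 : 0.175 ≤ a) (h1 : a ≤ 0.7)
    (hz : z = a * (0.79 - 0.12 * a - 0.22 * a ^ 2)) :
    z * Real.exp (-z) < 0.796 * (a * Real.exp (-a)) := by
  set u := a - z with hu
  have hu' : u = a * (0.21 + 0.12 * a + 0.22 * a ^ 2) := by rw [hu, hz]; ring
  have hu0 : 0 ≤ u := by rw [hu']; positivity
  have hu1 : u ≤ 0.3 := by
    rw [hu']
    have h2 : 0.21 + 0.12 * a + 0.22 * a ^ 2 ≤ 0.402 := by nlinarith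
    nlinarith
  have h2 : 1 - u + 0.45 * u ^ 2 ≤ Real.exp (-u) := by
    refine le_trans ?_ (exp_neg_ge_three hu0)
    nlinarith [mul_nonneg (sq_nonneg u) (sub_nonneg.2 hu1)]
  -- the Bernstein coefficients of the difference are positive
  have h3 : 0.79 - 0.12 * a - 0.22 * a ^ 2 < 0.796 * (1 - u + 0.45 * u ^ 2) := by
    have hl : 0 ≤ a - 0.175 := by linarith
    have hr : 0 ≤ 0.7 - a := by linarith
    have hb : ∀ k : ℕ, 0 ≤ (a - 0.175) ^ k * (0.7 - a) ^ (6 - k) := fun k => by positivity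
    have b0 := hb 0
    have b1 := hb 1
    have b2 := hb 2
    have b3 := hb 3
    have b4 := hb 4
    have b5 := hb 5
    have b6 := hb 6
    norm_num only at b0 b1 b2 b3 b4 b5 b6
    rw [hu']
    linarith
  have ha : 0 < a := by linarith
  calc z * Real.exp (-z) = a * (0.79 - 0.12 * a - 0.22 * a ^ 2) * Real.exp (-z) := by rw [← hz]
    _ < a * (0.796 * Real.exp (-u)) * Real.exp (-z) := by
        refine mul_lt_mul_of_pos_right (mul_lt_mul_of_pos_left (h3.trans_le ?_) ha)
          (Real.exp_pos _)
        linarith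
    _ = 0.796 * (a * (Real.exp (-u) * Real.exp (-z))) := by ring
    _ = _ := by rw [← Real.exp_add, hu]; ring_nf

/-- No price from `2.214` on earns the share `0.796` under the shifted exponential distribution
starting at `1.75`. -/
lemma price_lt_of_rev_shiftedExp {v : ℝ}
    (hv : 0.796 * OPT (shiftedExp 1.75 (by norm_num)) ≤ rev (shiftedExp 1.75 (by norm_num)) v) :
    v < 2.214 := by
  have h0 : 0 < v := by
    refine pos_of_rev_pos (lt_of_lt_of_le ?_ hv)
    have := le_OPT_shiftedExp (m := 1.75) (hm := by norm_num)
    linarith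
  have h1 : 0.796 * 1.75 ≤ v * Real.exp (1.75 - v) := by
    refine le_trans ?_ (hv.trans (mul_le_mul_of_nonneg_left (surv_shiftedExp_le v) h0.le))
    exact mul_le_mul_of_nonneg_left le_OPT_shiftedExp (by norm_num)
  have h2 : 2.214 * Real.exp (-0.464) < 0.796 * 1.75 := by
    have := exp_neg_le_four (x := 0.464) (by norm_num)
    norm_num at this ⊢
    linarith
  have h3 : 2.214 * Real.exp (-2.214) < v * Real.exp (-v) := by
    have e1 : Real.exp (-2.214) = Real.exp (-0.464) * Real.exp (-1.75) := by
      rw [← Real.exp_add]; norm_num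
    have e2 : Real.exp (-v) = Real.exp (1.75 - v) * Real.exp (-1.75) := by
      rw [← Real.exp_add]; ring_nf
    rw [e1, e2, ← mul_assoc, ← mul_assoc]
    exact mul_lt_mul_of_pos_right (h2.trans_le h1) (Real.exp_pos _)
  exact lt_of_mul_exp_neg_lt (by norm_num) h3

/-- An antiderivative of `β exp (-β B) L B` for the cubic `L B = 0.79 B - 0.0084 B² - 0.001078 B³`
and `β = 0.93`. -/
def averagedPrice (B : ℝ) : ℝ :=
  -(Real.exp (-(0.93 * B)) * ((0.79 * B - 0.0084 * B ^ 2 - 0.001078 * B ^ 3) +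
    (0.79 - 0.0168 * B - 0.003234 * B ^ 2) / 0.93 + (-0.0168 - 0.006468 * B) / 0.93 ^ 2 -
    0.006468 / 0.93 ^ 3))

lemma hasDerivAt_averagedPrice (B : ℝ) : HasDerivAt averagedPrice (0.93 * Real.exp (-(0.93 * B)) *
    (0.79 * B - 0.0084 * B ^ 2 - 0.001078 * B ^ 3)) B := by
  have h1 : HasDerivAt (fun s : ℝ => -(0.93 * s)) (-(0.93 * 1)) B :=
    ((hasDerivAt_id B).const_mul 0.93).neg
  have h2 : HasDerivAt (fun B : ℝ => (0.79 * B - 0.0084 * B ^ 2 - 0.001078 * B ^ 3) +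
    (0.79 - 0.0168 * B - 0.003234 * B ^ 2) / 0.93 + (-0.0168 - 0.006468 * B) / 0.93 ^ 2 -
    0.006468 / 0.93 ^ 3) ((0.79 - 0.0168 * B - 0.003234 * B ^ 2) +
    (- 0.0168 - 0.006468 * B) / 0.93 + (- 0.006468) / 0.93 ^ 2) B := by
    have d1 := hasDerivAt_id B
    have d2 := (hasDerivAt_id B).pow 2
    have d3 := (hasDerivAt_id B).pow 3
    refine ((((((d1.const_mul 0.79).sub (d2.const_mul 0.0084)).sub (d3.const_mul 0.001078)).add
      ((((d1.const_mul 0.0168).const_sub 0.79).sub (d2.const_mul 0.003234)).div_const 0.93)).add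
      (((d1.const_mul 0.006468).const_sub (-0.0168)).div_const (0.93 ^ 2))).sub_const
      (0.006468 / 0.93 ^ 3)).congr_deriv ?_
    simp only [id]
    ring
  refine (h1.exp.mul h2).neg.congr_deriv ?_
  ring

/-- An antiderivative of `0.796 s (exp (-s) - 0.07 exp (-0.07 s) exp (-0.93 * 2.5))`. -/
def pointMassPrice (s : ℝ) : ℝ :=
  0.796 * (-(Real.exp (-s) * (s + 1)) +
    Real.exp (-(0.93 * 2.5)) * (Real.exp (-(0.07 * s)) * (s + 1 / 0.07)))

lemma hasDerivAt_pointMassPrice (s : ℝ) : HasDerivAt pointMassPrice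
    (0.796 * (s * (Real.exp (-s) - 0.07 * Real.exp (-(0.07 * s)) * Real.exp (-(0.93 * 2.5)))))
    s := by
  have h1 : HasDerivAt (fun s : ℝ => -(0.07 * s)) (-(0.07 * 1)) s :=
    ((hasDerivAt_id s).const_mul 0.07).neg
  refine (((((hasDerivAt_exp_neg s).mul ((hasDerivAt_id s).add_const 1)).neg).add
    ((h1.exp.mul ((hasDerivAt_id s).add_const (1 / 0.07))).const_mul
      (Real.exp (-(0.93 * 2.5))))).const_mul 0.796).congr_deriv ?_
  simp only [id]
  ring

/-- After division by `exp 1.75`: the lower bound for the expected payment under the shifted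
exponential distribution, about `2.2208`, exceeds `2.214`. -/
lemma expected_payment_gt : 2.214 * Real.exp (-1.75) <
    (averagedPrice 10 - averagedPrice 2.5) + (pointMassPrice 2.5 - pointMassPrice 1.82) := by
  have f1 := exp_neg_ge_five (x := 0.575) (by norm_num)
  have f2 : Real.exp (-7.55) ≤ 0.0006 := by
    have h1 := exp_neg_le_four (x := 0.755) (by norm_num)
    have h2 : Real.exp (-7.55) = Real.exp (-0.755) ^ 10 := by
      rw [← Real.exp_nat_mul]; norm_num
    rw [h2]
    refine (pow_le_pow_left₀ (Real.exp_pos _).le h1 10).trans ?_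
    norm_num
  have f3 := exp_neg_ge_three (x := 0.07) (by norm_num)
  have f4 := exp_neg_ge_five (x := 0.75) (by norm_num)
  have f5 : Real.exp (-0.7024) ≤ 0.49547 := by
    have h1 := exp_neg_le_four (x := 0.3512) (by norm_num)
    have h2 : Real.exp (-0.7024) = Real.exp (-0.3512) ^ 2 := by
      rw [← Real.exp_nat_mul]; norm_num
    rw [h2]
    refine (pow_le_pow_left₀ (Real.exp_pos _).le h1 2).trans ?_
    norm_num
  have e : ∀ x y : ℝ, x = y + 1.75 → Real.exp (-x) = Real.exp (-y) * Real.exp (-1.75) := by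
    rintro x y rfl
    rw [← Real.exp_add]
    ring_nf
  have e6 : Real.exp (-(0.93 * 2.5)) * Real.exp (-(0.07 * 1.82)) =
      Real.exp (-0.7024) * Real.exp (-1.75) := by
    rw [← Real.exp_add, ← Real.exp_add]; norm_num
  have e7 : Real.exp (-(0.93 * 2.5)) * Real.exp (-(0.07 * 2.5)) =
      Real.exp (-0.75) * Real.exp (-1.75) := by
    rw [← Real.exp_add, ← Real.exp_add]; norm_num
  rw [averagedPrice, averagedPrice, pointMassPrice, pointMassPrice, ← mul_assoc (Real.exp _),
    ← mul_assoc (Real.exp _), e6, e7, e (0.93 * 2.5) 0.575 (by norm_num),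
    e (0.93 * 10) 7.55 (by norm_num), e 1.82 0.07 (by norm_num), e 2.5 0.75 (by norm_num)]
  generalize Real.exp (-0.575) = x₁ at f1 ⊢
  generalize Real.exp (-7.55) = x₂ at f2 ⊢
  generalize Real.exp (-0.07) = x₃ at f3 ⊢
  generalize Real.exp (-0.75) = x₄ at f4 ⊢
  generalize Real.exp (-0.7024) = x₅ at f5 ⊢
  have key : 0 < -2.214 + x₁ * ((0.79 * 2.5 - 0.0084 * 2.5 ^ 2 - 0.001078 * 2.5 ^ 3) +
      (0.79 - 0.0168 * 2.5 - 0.003234 * 2.5 ^ 2) / 0.93 + (-0.0168 - 0.006468 * 2.5) / 0.93 ^ 2 -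
      0.006468 / 0.93 ^ 3) - x₂ * ((0.79 * 10 - 0.0084 * 10 ^ 2 - 0.001078 * 10 ^ 3) +
      (0.79 - 0.0168 * 10 - 0.003234 * 10 ^ 2) / 0.93 + (-0.0168 - 0.006468 * 10) / 0.93 ^ 2 -
      0.006468 / 0.93 ^ 3) +
      0.796 * (2.82 * x₃ + (1 / 0.07 - 1) * x₄ - (1.82 + 1 / 0.07) * x₅) := by
    norm_num at f1 f2 f3 f4 f5 ⊢
    linarith
  have := mul_pos key (Real.exp_pos (-1.75))
  linarith

/-- Under the shifted exponential distribution starting at `1.75`, admissible payments cost more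
than every price that earns the share `0.796`. -/
lemma not_feasible_upper : ¬ Feasible 0.796 := by
  intro hf
  have hM : (0 : ℝ) ≤ 1.75 := by norm_num
  obtain ⟨g, hg, v, hv, hgv⟩ := hf (shiftedExp 1.75 hM) isMHR_shiftedExp
    (lt_of_lt_of_le (by norm_num) le_OPT_shiftedExp)
  have hv' := price_lt_of_rev_shiftedExp hv
  -- `1.82` is nearly the least point for which the payments below it cancel
  have hK : Real.exp (-(0.93 * 2.5)) * (1 - Real.exp (-(0.07 * 1.82))) ≤
      Real.exp (-1.75) - Real.exp (-1.82) := by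
    have f1 := exp_neg_le_four (x := 0.575) (by norm_num)
    have f2 := exp_neg_ge_three (x := 0.1274) (by norm_num)
    have f3 := exp_neg_le_two (x := 0.07) (by norm_num)
    have e1 : Real.exp (-(0.93 * 2.5)) = Real.exp (-0.575) * Real.exp (-1.75) := by
      rw [← Real.exp_add]; norm_num
    have e2 : Real.exp (-1.82) = Real.exp (-0.07) * Real.exp (-1.75) := by
      rw [← Real.exp_add]; norm_num
    have h1 : Real.exp (-0.575) * (1 - Real.exp (-(0.07 * 1.82))) ≤ 0.5633 * 0.11964 := by
      rw [show (0.07 * 1.82 : ℝ) = 0.1274 by norm_num]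
      refine mul_le_mul (f1.trans (by norm_num)) (by norm_num at f2 ⊢; linarith) ?_ (by norm_num)
      rw [sub_nonneg, Real.exp_le_one_iff]
      norm_num
    have h2 : 0.5633 * 0.11964 ≤ 1 - Real.exp (-0.07) := by norm_num at f3 ⊢; linarith
    rw [e1, e2, mul_right_comm]
    linarith [mul_le_mul_of_nonneg_right (h1.trans h2) (Real.exp_pos (-1.75)).le]
  -- near-optimal parameters: rate `0.07`, truncation points in `(2.5, 10)`, where the price
  -- `L B` under the truncated exponential distribution is bounded by `cubic_price_lt`
  have hJ := hg.le_lintegral_exp (α := 0.07) (β := 0.93) (b := 2.5) (c := 10) (s₀ := 1.82)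
    (L := fun B => 0.79 * B - 0.0084 * B ^ 2 - 0.001078 * B ^ 3) (by norm_num) (by norm_num)
    (by norm_num) hM (by norm_num) (by norm_num) (by norm_num) (fun B hB1 hB2 => by
      refine hg.le_lintegral _ _ _ (by norm_num) (by linarith) (by linarith) (by nlinarith) ?_
      have := cubic_price_lt (a := 0.07 * B) (z := 0.07 * (0.79 * B - 0.0084 * B ^ 2 -
        0.001078 * B ^ 3)) (by linarith) (by linarith) (by ring)
      linarith) hK
  rw [restrict_Ioo_eq_restrict_Ioc,
    lintegral_ofReal_of_hasDerivAt (by norm_num)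
      hasDerivAt_averagedPrice (by fun_prop) (fun B h1 h2 => by
        have : 0 ≤ B * (0.79 - 0.0084 * B - 0.001078 * B ^ 2) :=
          mul_nonneg (by linarith) (by nlinarith)
        have h3 : 0 ≤ 0.79 * B - 0.0084 * B ^ 2 - 0.001078 * B ^ 3 := by linarith
        positivity),
    lintegral_ofReal_of_hasDerivAt (by norm_num) hasDerivAt_pointMassPrice (by fun_prop)
      (fun s h1 h2 => by
        have h3 : Real.exp (-(0.07 * s)) * Real.exp (-(0.93 * 2.5)) ≤ Real.exp (-s) := by
          rw [← Real.exp_add, Real.exp_le_exp]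
          linarith
        have h4 : 0 ≤ s := by linarith
        have h5 : 0 ≤ Real.exp (-s) - 0.07 * Real.exp (-(0.07 * s)) * Real.exp (-(0.93 * 2.5)) := by
          have := Real.exp_pos (-s)
          linarith
        positivity)] at hJ
  rw [shiftedExp_law, lintegral_shiftedExp _ hg.mono.measurable] at hgv
  have h1 := ENNReal.ofReal_add_le.trans hJ
  have h2 := (ENNReal.ofReal_le_ofReal expected_payment_gt.le).trans h1
  have h3 := (mul_le_mul_right h2 (ENNReal.ofReal (Real.exp 1.75))).trans hgv
  rw [← ENNReal.ofReal_mul (Real.exp_pos _).le, mul_left_comm, ← Real.exp_add, add_neg_cancel,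
    Real.exp_zero, mul_one, ENNReal.ofReal_le_ofReal_iff'] at h3
  rcases h3 with h3 | h3
  · linarith
  · norm_num at h3

/-! ### The largest ratio -/

lemma IsAdmissible.anti {Γ Γ' : ℝ} (h : Γ' ≤ Γ) {g : ℝ → ℝ≥0∞} (hg : IsAdmissible Γ g) :
    IsAdmissible Γ' g :=
  ⟨hg.mono, fun c B L hc hB hcB hLB hL => hg.le_lintegral c B L hc hB hcB hLB
    (hL.trans_le (mul_le_mul_of_nonneg_right h (by positivity)))⟩

lemma Feasible.anti {Γ Γ' : ℝ} (h : Γ' ≤ Γ) (hf : Feasible Γ) : Feasible Γ' := by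
  intro F hF hO
  obtain ⟨g, hg, v, hv, hgv⟩ := hf F hF hO
  exact ⟨g, hg.anti h, v, (mul_le_mul_of_nonneg_right h hO.le).trans hv, hgv⟩

/-- The feasible shares of the optimal revenue have a maximum. -/
lemma exists_isGreatest_feasible :
    ∃ Γ : ℝ, IsGreatest {γ | Feasible γ} Γ ∧ 0.79 ≤ Γ ∧ Γ ≤ 0.796 := by
  set S : Set ℝ := {γ | Feasible γ} with hS
  have hne : S.Nonempty := ⟨0.79, feasible_lower⟩
  have hub : (0.796 : ℝ) ∈ upperBounds S := fun γ hγ =>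
    le_of_not_gt fun h => not_feasible_upper (Feasible.anti h.le hγ)
  have hlow : 0.79 ≤ sSup S := le_csSup ⟨_, hub⟩ feasible_lower
  obtain ⟨γ, -, hγ, hγS⟩ := exists_seq_tendsto_sSup hne ⟨_, hub⟩
  exact ⟨sSup S, ⟨Feasible.of_tendsto (by linarith) hγ hγS, fun γ hγ => le_csSup ⟨_, hub⟩ hγ⟩,
    hlow, csSup_le hne hub⟩

end HiddenPricing

end

theorem mainTheorem7 :
    ∃ Γ : ℝ,
      IsGreatest
        {r : EReal | ∃ M : HiddenPricing.Mechanism,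
          HiddenPricing.IsMonotoneHiddenPricing M ∧ r = HiddenPricing.approxRatio M}
        (Γ : EReal) ∧
      0.79 ≤ Γ ∧ Γ ≤ 0.796 := by
  obtain ⟨Γ, ⟨hΓ, hmax⟩, hlow, hup⟩ := HiddenPricing.exists_isGreatest_feasible
  have hub : ∀ M, HiddenPricing.IsMonotoneHiddenPricing M →
      HiddenPricing.approxRatio M ≤ (Γ : EReal) := by
    intro M hM
    by_contra hcon
    obtain ⟨γ, hγ, hγM⟩ := EReal.lt_iff_exists_real_btwn.1 (not_le.1 hcon)
    have h1 : Γ < γ := EReal.coe_lt_coe_iff.1 hγ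
    exact absurd (hmax (HiddenPricing.feasible_of_le_approxRatio (by linarith) hM hγM.le))
      (not_le.2 h1)
  obtain ⟨M, hM, hr⟩ :=
    HiddenPricing.exists_mechanism_of_feasible (by linarith) (by linarith) hΓ
  refine ⟨Γ, ⟨⟨M, hM, le_antisymm hr (hub M hM)⟩, ?_⟩, hlow, hup⟩
  rintro _ ⟨M', hM', rfl⟩
  exact hub M' hM'
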